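/- Let $n$ be a natural number, let $R \ge 1$ and let $Q \subset \mathbb{R}^n$ be a unit cube parallel to the axes, that is, a translate of $(0,1)^n$ or of its closure. Let $\mu$ be a probability measure supported on $Q$ with a density $f : Q \to [0,\infty)$ that is log-concave (that is, $-\log f : Q \to (-\infty,\infty]$ is convex) and satisfies $$f(\lambda x + (1-\lambda) y) \le R\,[\lambda f(x) + (1-\lambda) f(y)]$$ for all $0 < \lambda < 1$ and all $x, y \in Q$ such that $x - y$ is proportional to one of the standard unit vectors (that is, $x-y$ has at most one non-zero entry). Let $A \subseteq \mathbb{R}^n$ be a Borel-measurable set with $\mu(A) \ge 1/2$. Then, for all $t > 0$, $$\mu(A + tB^n) \ge 1 - \exp\left(-\frac{t^2}{\alpha^2}\right), \qquad \alpha = 3R,$$ where $B^n = \{x \in \mathbb{R}^n : |x| \le 1\}$ is the closed Euclidean unit ball and $A + tB^n = \{x + ty : x \in A,\ y \in B^n\}$. -/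

import Mathlib

open MeasureTheory
open scoped Pointwise

/-- `Q` is a unit cube parallel to the axes: a translate of `(0, 1)^n` or of its closure. -/
def IsUnitCube {n : ℕ} (Q : Set (EuclideanSpace ℝ (Fin n))) : Prop :=
  ∃ a : EuclideanSpace ℝ (Fin n),
    Q = {x | ∀ i, x i ∈ Set.Ioo (a i) (a i + 1)} ∨ Q = {x | ∀ i, x i ∈ Set.Icc (a i) (a i + 1)}

/-- `f` is non-negative and log-concave on `Q`, that is, `-log f`, with values in `(-∞, ∞]`,
is convex. As `0 < l < 1`, the convention `0 ^ l = 0` gives the right meaning to the inequality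
at the zeros of `f`. -/
def IsLogConcaveOn {n : ℕ} (Q : Set (EuclideanSpace ℝ (Fin n)))
    (f : EuclideanSpace ℝ (Fin n) → ℝ) : Prop :=
  Convex ℝ Q ∧ (∀ x ∈ Q, 0 ≤ f x) ∧
    ∀ x ∈ Q, ∀ y ∈ Q, ∀ l : ℝ, 0 < l → l < 1 →
      f x ^ l * f y ^ (1 - l) ≤ f (l • x + (1 - l) • y)

/-- `v` is proportional to one of the standard unit vectors: it has at most one non-zero entry. -/
def IsCoordinateDirection {n : ℕ} (v : EuclideanSpace ℝ (Fin n)) : Prop :=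
  ∀ i j, v i ≠ 0 → v j ≠ 0 → i = j

/-- `f` is `R`-approximately convex on `Q` along the coordinate directions. -/
def IsApproxConvexAlongAxes {n : ℕ} (R : ℝ) (Q : Set (EuclideanSpace ℝ (Fin n)))
    (f : EuclideanSpace ℝ (Fin n) → ℝ) : Prop :=
  ∀ x ∈ Q, ∀ y ∈ Q, IsCoordinateDirection (x - y) → ∀ l : ℝ, 0 < l → l < 1 →
    f (l • x + (1 - l) • y) ≤ R * (l * f x + (1 - l) * f y)

/-- `μ` is a measure supported on `Q` with density `f` (a function on `Q`) with respect to
Lebesgue measure. -/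
def HasDensityOn {n : ℕ} (μ : Measure (EuclideanSpace ℝ (Fin n)))
    (Q : Set (EuclideanSpace ℝ (Fin n))) (f : EuclideanSpace ℝ (Fin n) → ℝ) : Prop :=
  AEMeasurable f (volume.restrict Q) ∧
    μ = (volume.restrict Q).withDensity (fun x => ENNReal.ofReal (f x))

/-! The proof is by mass transport. Let `exp g` be the density on the unit cube, with `g` concave
and Lipschitz, and let `T` be the Knothe map to a tilted density `exp (q + g)`: it is triangular,
and `T_i` increases in `x_i`, with derivative `D_i`. Take logarithms in the Jacobian equation and
use `g (T x) - g x ≤ ∇g x · (T x - x)`. Then the log of the ratio of the masses is at most `q (T x)`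
plus a sum over `i` of terms `∂_i g (T_i - x_i) + log D_i`. By Fubini, each term can be integrated
along lines in direction `i`.

On a line, integration by parts leaves the claim that the integral of `(D - 1 - log D) exp γ`
dominates `(T - s)^2 exp γ / (2R)`. A log-concave weight bounded by `R` times its larger end value
is monotone up to the factor `R`. Hence on one side of each point `x` the weight is at least `exp (γ
x) / R`, and there Jensen's inequality for the logarithm suffices (`weighted_sq_displacement_le`).

The sum over `i` is the dual transportation-entropy inequality `integral_exp_add_le`, with cost `|x
- y|^2 / (2R)`. Two uses of it, with `δ` the distance to `A`, give Maurey's property `μ(A) ∫ exp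
(δ^2 / (4R)) dμ ≤ 1`. By Markov, the complement of the `t`-neighbourhood has measure `b` with `b exp
(t^2 / (4R)) ≤ 2`. As `b ≤ 1/2`, this yields `b ≤ exp (-t^2 / (8R))`, and `8R ≤ 9R^2`.

General densities are reached by truncating `log f` from above and taking sup-convolutions, which
keep both concavity and the coordinate condition. -/

/-! ### The one-dimensional transport inequality -/

/-- `A` and `B` are the lengths of an interval and of its image. For `A ≤ B` the bound comes from
`log s ≤ sinh (log s) = (s - 1/s) / 2`, otherwise from `log (1 + x) ≥ 2x / (x + 2)`. That the
lengths are at most `1` makes the quadratic gain absolute. -/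
theorem mul_log_div_le {A B : ℝ} (hA : 0 < A) (hA1 : A ≤ 1) (hB : 0 < B) (hB1 : B ≤ 1) :
    A * Real.log (B / A) ≤ B - A - (B - A) ^ 2 / 2 := by
  rcases le_total A B with h | h
  · have hs : 0 < B / A := by positivity
    have h0 : 0 ≤ Real.log (B / A) := Real.log_nonneg ((one_le_div hA).2 h)
    have h1 := Real.self_le_sinh_iff.2 h0
    rw [Real.sinh_log hs, inv_div] at h1
    have h2 : A * Real.log (B / A) ≤ A * ((B / A - A / B) / 2) := by gcongr
    refine h2.trans ?_
    have h3 : A * ((B / A - A / B) / 2) = (B - A) * ((B + A) / (2 * B)) := by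
      field_simp; ring
    have h4 : (B + A) / (2 * B) ≤ 1 - (B - A) / 2 := by
      rw [div_le_iff₀ (by positivity)]
      nlinarith [mul_nonneg (sub_nonneg.2 h) (sub_nonneg.2 hB1)]
    rw [h3]
    nlinarith [mul_le_mul_of_nonneg_left h4 (sub_nonneg.2 h)]
  · have hx : 0 ≤ A / B - 1 := by
      rw [sub_nonneg]; exact (one_le_div hB).2 h
    have h1 := Real.le_log_one_add_of_nonneg hx
    have h2 : Real.log (1 + (A / B - 1)) = - Real.log (B / A) := by
      rw [← Real.log_inv, inv_div]; ring_nf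
    have h3 : 2 * (A / B - 1) / (A / B - 1 + 2) = 2 * (A - B) / (A + B) := by
      have : A / B - 1 + 2 ≠ 0 := by positivity
      field_simp; ring
    rw [h2, h3] at h1
    have h4 : A * (2 * (A - B) / (A + B)) = (A - B) * (2 * A / (A + B)) := by ring
    have h5 : 1 + (A - B) / 2 ≤ 2 * A / (A + B) := by
      rw [le_div_iff₀ (by positivity)]
      nlinarith [mul_nonneg (sub_nonneg.2 h) (by linarith : 0 ≤ 2 - A - B)]
    have h6 := mul_le_mul_of_nonneg_left h1 hA.le
    rw [h4] at h6
    nlinarith [mul_le_mul_of_nonneg_left h5 (sub_nonneg.2 h)]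

/-- Jensen's inequality, in the form of the tangent to `log` at the mean slope `s`, reduces to
constant `D`, where `mul_log_div_le` applies. -/
theorem sq_displacement_le_integral {T D : ℝ → ℝ} (hD : Continuous D) (hD0 : ∀ x, 0 < D x)
    (hT : ∀ x, HasDerivAt T (D x) x) {a b : ℝ} (hab : a ≤ b) (hb : b - a ≤ 1)
    (hTb : T b - T a ≤ 1) :
    ((T b - b) - (T a - a)) ^ 2 / 2 ≤ ∫ x in a..b, (D x - 1 - Real.log (D x)) := by
  rcases hab.eq_or_lt with rfl | hab
  · simp
  have hmono : StrictMono T := strictMono_of_hasDerivAt_pos hT hD0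
  have hA : 0 < b - a := by linarith
  have hB : 0 < T b - T a := by linarith [hmono hab]
  set s := (T b - T a) / (b - a) with hs
  have hs0 : 0 < s := by positivity
  have hlogc : Continuous fun x => Real.log (D x) := hD.log fun x => (hD0 x).ne'
  have hint : ∫ x in a..b, D x = T b - T a :=
    intervalIntegral.integral_eq_sub_of_hasDerivAt (fun x _ => hT x) (hD.intervalIntegrable _ _)
  have h1 : ∫ x in a..b, (D x - Real.log s - D x / s) ≤
      ∫ x in a..b, (D x - 1 - Real.log (D x)) := by
    apply intervalIntegral.integral_mono_on hab.le
    · exact Continuous.intervalIntegrable (by fun_prop) _ _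
    · exact Continuous.intervalIntegrable (by fun_prop) _ _
    · intro x _
      have := Real.log_le_sub_one_of_pos (div_pos (hD0 x) hs0)
      rw [Real.log_div (hD0 x).ne' hs0.ne'] at this
      linarith
  have h2 : ∫ x in a..b, (D x - Real.log s - D x / s) =
      (T b - T a) - (b - a) * Real.log s - (b - a) := by
    rw [intervalIntegral.integral_sub, intervalIntegral.integral_sub,
      intervalIntegral.integral_div, hint, intervalIntegral.integral_const, smul_eq_mul]
    · rw [hs]; field_simp
    · exact hD.intervalIntegrable _ _
    · simp
    · exact Continuous.intervalIntegrable (by fun_prop) _ _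
    · exact Continuous.intervalIntegrable (by fun_prop) _ _
  have h3 := mul_log_div_le hA hb hB hTb
  rw [← hs] at h3
  calc _ = (T b - T a - (b - a)) ^ 2 / 2 := by ring
    _ ≤ _ := by linarith

theorem sub_one_sub_log_nonneg {x : ℝ} (hx : 0 < x) : 0 ≤ x - 1 - Real.log x := by
  linarith [Real.log_le_sub_one_of_pos hx]

/-- A concave function on `[0, 1]` that is, up to an additive constant, at most the maximum of its
values at the end points is, up to this constant, monotone or antitone. -/
theorem exp_concave_monotone_or_antitone {R : ℝ} (hR : 1 ≤ R) {γ : ℝ → ℝ}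
    (hc : ConcaveOn ℝ Set.univ γ)
    (he : ∀ s ∈ Set.Icc (0 : ℝ) 1,
      Real.exp (γ s) ≤ R * max (Real.exp (γ 0)) (Real.exp (γ 1))) :
    (∀ x y, 0 ≤ x → x ≤ y → y ≤ 1 → Real.exp (γ x) ≤ R * Real.exp (γ y)) ∨
      (∀ x y, 0 ≤ x → x ≤ y → y ≤ 1 → Real.exp (γ y) ≤ R * Real.exp (γ x)) := by
  have hpos : 0 ≤ R := by linarith
  rcases le_total (γ 0) (γ 1) with h | h
  · left
    intro x y hx hxy hy
    -- On `[x, 1]` a concave function is at least its smaller end value. If that is `γ 1`, the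
    -- larger of the two values on the faces, the hypothesis bounds `exp (γ x)` by `R * exp (γ 1)`.
    have h1 : min (γ x) (γ 1) ≤ γ y :=
      hc.min_le_of_mem_Icc (Set.mem_univ _) (Set.mem_univ _) ⟨hxy, hy⟩
    rcases min_le_iff.1 h1 with h2 | h2
    · have := Real.exp_le_exp.2 h2
      nlinarith [Real.exp_pos (γ y)]
    · have h3 := he x ⟨hx, hxy.trans hy⟩
      rw [max_eq_right (Real.exp_le_exp.2 h)] at h3
      exact h3.trans (by gcongr)
  · right
    intro x y hx hxy hy
    have h1 : min (γ 0) (γ y) ≤ γ x :=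
      hc.min_le_of_mem_Icc (Set.mem_univ _) (Set.mem_univ _) ⟨hx, hxy⟩
    rcases min_le_iff.1 h1 with h2 | h2
    · have h3 := he y ⟨hx.trans hxy, hy⟩
      rw [max_eq_left (Real.exp_le_exp.2 h)] at h3
      exact h3.trans (by gcongr)
    · have := Real.exp_le_exp.2 h2
      nlinarith [Real.exp_pos (γ x)]

theorem weighted_sq_displacement_le {R : ℝ} (hR : 1 ≤ R) {γ T D : ℝ → ℝ} (hγ : Continuous γ)
    (hc : ConcaveOn ℝ Set.univ γ)
    (he : ∀ s ∈ Set.Icc (0 : ℝ) 1,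
      Real.exp (γ s) ≤ R * max (Real.exp (γ 0)) (Real.exp (γ 1)))
    (hD : Continuous D) (hD0 : ∀ x, 0 < D x) (hT : ∀ x, HasDerivAt T (D x) x)
    (hT0 : T 0 = 0) (hT1 : T 1 = 1) {x : ℝ} (hx : x ∈ Set.Icc (0 : ℝ) 1) :
    (T x - x) ^ 2 / (2 * R) * Real.exp (γ x) ≤
      ∫ y in (0 : ℝ)..1, (D y - 1 - Real.log (D y)) * Real.exp (γ y) := by
  have hlogc : Continuous fun x => Real.log (D x) := hD.log fun x => (hD0 x).ne'
  have hmono : Monotone T := (strictMono_of_hasDerivAt_pos hT hD0).monotone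
  have hTx0 : 0 ≤ T x := hT0 ▸ hmono hx.1
  have hTx1 : T x ≤ 1 := hT1 ▸ hmono hx.2
  have hRpos : 0 < R := by linarith
  have hii : ∀ a b : ℝ, IntervalIntegrable
      (fun y => (D y - 1 - Real.log (D y)) * Real.exp (γ y)) volume a b :=
    fun a b => Continuous.intervalIntegrable (by fun_prop) _ _
  have hpos : ∀ y, 0 ≤ (D y - 1 - Real.log (D y)) * Real.exp (γ y) := fun y =>
    mul_nonneg (sub_one_sub_log_nonneg (hD0 y)) (Real.exp_pos _).le
  -- `[a, b]` will be `[x, 1]` or `[0, x]`, whichever side has weight at least `exp (γ x) / R`. As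
  -- `T` fixes `0` and `1`, the displacement at the outer end is zero.
  have key : ∀ a b : ℝ, 0 ≤ a → a ≤ b → b ≤ 1 →
      (∀ y ∈ Set.Icc a b, Real.exp (γ x) ≤ R * Real.exp (γ y)) →
      ((T b - b) - (T a - a)) ^ 2 = (T x - x) ^ 2 → T b - T a ≤ 1 →
      (T x - x) ^ 2 / (2 * R) * Real.exp (γ x) ≤
        ∫ y in (0 : ℝ)..1, (D y - 1 - Real.log (D y)) * Real.exp (γ y) := by
    intro a b ha hab hb hy hsq hTab
    have h1 := sq_displacement_le_integral hD hD0 hT hab (by linarith) hTab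
    rw [hsq] at h1
    calc (T x - x) ^ 2 / (2 * R) * Real.exp (γ x)
        = ((T x - x) ^ 2 / 2) * (Real.exp (γ x) / R) := by field_simp
      _ ≤ (∫ y in a..b, (D y - 1 - Real.log (D y))) * (Real.exp (γ x) / R) := by gcongr
      _ = ∫ y in a..b, (D y - 1 - Real.log (D y)) * (Real.exp (γ x) / R) := by
          rw [intervalIntegral.integral_mul_const]
      _ ≤ ∫ y in a..b, (D y - 1 - Real.log (D y)) * Real.exp (γ y) := by
          apply intervalIntegral.integral_mono_on hab
          · exact Continuous.intervalIntegrable (by fun_prop) _ _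
          · exact hii _ _
          · intro y hyab
            have : Real.exp (γ x) / R ≤ Real.exp (γ y) := by
              rw [div_le_iff₀' hRpos]; exact hy y hyab
            exact mul_le_mul_of_nonneg_left this (sub_one_sub_log_nonneg (hD0 y))
      _ ≤ _ := by
          apply intervalIntegral.integral_mono_interval ha hab hb
          · exact Filter.Eventually.of_forall hpos
          · exact hii _ _
  rcases exp_concave_monotone_or_antitone hR hc he with h | h
  · exact key x 1 hx.1 hx.2 le_rfl (fun y hy => h x y hx.1 hy.1 hy.2) (by rw [hT1]; ring)
      (by linarith)
  · exact key 0 x le_rfl hx.1 hx.2 (fun y hy => h y x hy.1 hy.2 hx.2) (by rw [hT0]; ring)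
      (by linarith)

theorem lipschitzOnWith_exp_Iic (M : ℝ) :
    LipschitzOnWith (Real.exp M).toNNReal Real.exp (Set.Iic M) := by
  apply (convex_Iic M).lipschitzOnWith_of_nnnorm_deriv_le
  · intro x _; exact Real.differentiableAt_exp
  · intro x hx
    rw [Real.deriv_exp, ← NNReal.coe_le_coe, coe_nnnorm, Real.norm_of_nonneg (Real.exp_pos _).le,
      Real.coe_toNNReal _ (Real.exp_pos _).le]
    exact Real.exp_le_exp.2 hx

/-- The boundary terms vanish because `T` fixes both end points. A Lipschitz `γ` is enough, by
integration by parts for absolutely continuous functions. -/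
theorem integral_mul_deriv_exp {C : NNReal} {γ T D : ℝ → ℝ} (hγ : LipschitzWith C γ)
    (hD : Continuous D) (hT : ∀ x, HasDerivAt T (D x) x) (hT0 : T 0 = 0) (hT1 : T 1 = 1) :
    ∫ s in (0 : ℝ)..1, deriv γ s * (T s - s) * Real.exp (γ s) =
      - ∫ s in (0 : ℝ)..1, (D s - 1) * Real.exp (γ s) := by
  have hu : ∀ x, HasDerivAt (fun s => T s - s) (D x - 1) x := fun x => (hT x).sub (hasDerivAt_id x)
  have hud : deriv (fun s => T s - s) = fun x => D x - 1 := funext fun x => (hu x).deriv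
  have huac : AbsolutelyContinuousOnInterval (fun s => T s - s) 0 1 := by
    have hcd : ContDiff ℝ 1 (fun s => T s - s) := by
      rw [contDiff_one_iff_deriv]
      exact ⟨fun x => (hu x).differentiableAt, by rw [hud]; fun_prop⟩
    obtain ⟨K, hK⟩ := hcd.contDiffOn.exists_lipschitzOnWith one_ne_zero (convex_uIcc (0 : ℝ) 1)
      isCompact_uIcc
    exact hK.absolutelyContinuousOnInterval
  have hhac : AbsolutelyContinuousOnInterval (fun s => Real.exp (γ s)) 0 1 := by
    obtain ⟨M, hM⟩ := (isCompact_uIcc (a := (0 : ℝ)) (b := 1)).bddAbove_image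
      hγ.continuous.continuousOn
    have := (lipschitzOnWith_exp_Iic M).comp (hγ.lipschitzOnWith (s := Set.uIcc 0 1))
      (fun x hx => hM (Set.mem_image_of_mem _ hx))
    exact this.absolutelyContinuousOnInterval
  have hhd : ∀ s, deriv (fun s => Real.exp (γ s)) s = Real.exp (γ s) * deriv γ s := by
    intro s
    by_cases h : DifferentiableAt ℝ γ s
    · exact deriv_exp h
    -- Where `γ` is not differentiable, neither is `exp ∘ γ`, and both derivatives have the default
    -- value `0`.
    · have h' : ¬ DifferentiableAt ℝ (fun s => Real.exp (γ s)) s := fun h2 => h (by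
        simpa using h2.log (Real.exp_pos _).ne')
      rw [deriv_zero_of_not_differentiableAt h, deriv_zero_of_not_differentiableAt h', mul_zero]
  have := huac.integral_mul_deriv_eq_deriv_mul hhac
  rw [hud] at this
  simp only [hhd, hT0, hT1, sub_self, zero_mul, zero_sub] at this
  rw [← this]
  apply intervalIntegral.integral_congr
  intro s _
  simp only; ring

/-- After integration by parts the last two terms contribute exactly `-I`, while the first integrand
is at most `I` at every point of an interval of length `1`. -/
theorem integral_line_le_zero {R : ℝ} (hR : 1 ≤ R) {C : NNReal} {γ T D : ℝ → ℝ}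
    (hγ : LipschitzWith C γ) (hc : ConcaveOn ℝ Set.univ γ)
    (he : ∀ s ∈ Set.Icc (0 : ℝ) 1,
      Real.exp (γ s) ≤ R * max (Real.exp (γ 0)) (Real.exp (γ 1)))
    (hD : Continuous D) (hD0 : ∀ x, 0 < D x) (hT : ∀ x, HasDerivAt T (D x) x)
    (hT0 : T 0 = 0) (hT1 : T 1 = 1) :
    ∫ s in (0 : ℝ)..1, ((T s - s) ^ 2 / (2 * R) + deriv γ s * (T s - s) + Real.log (D s)) *
      Real.exp (γ s) ≤ 0 := by
  have hγc := hγ.continuous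
  have hTc : Continuous T := continuous_iff_continuousAt.2 fun x => (hT x).continuousAt
  have hlogc : Continuous fun x => Real.log (D x) := hD.log fun x => (hD0 x).ne'
  set I := ∫ y in (0 : ℝ)..1, (D y - 1 - Real.log (D y)) * Real.exp (γ y) with hI
  have i1 : IntervalIntegrable (fun s => (T s - s) ^ 2 / (2 * R) * Real.exp (γ s)) volume 0 1 :=
    Continuous.intervalIntegrable (by fun_prop) _ _
  have i3 : IntervalIntegrable (fun s => Real.log (D s) * Real.exp (γ s)) volume 0 1 :=
    Continuous.intervalIntegrable (by fun_prop) _ _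
  have i4 : IntervalIntegrable (fun s => (D s - 1) * Real.exp (γ s)) volume 0 1 :=
    Continuous.intervalIntegrable (by fun_prop) _ _
  have i2 : IntervalIntegrable (fun s => deriv γ s * (T s - s) * Real.exp (γ s)) volume 0 1 := by
    have hγd : IntervalIntegrable (deriv γ) volume 0 1 :=
      (hγ.lipschitzOnWith (s := Set.uIcc 0 1)).absolutelyContinuousOnInterval.intervalIntegrable_deriv
    have := hγd.mul_continuousOn (g := fun s => (T s - s) * Real.exp (γ s)) (by fun_prop)
    simpa only [mul_assoc] using this
  have h1 : ∫ s in (0 : ℝ)..1, (T s - s) ^ 2 / (2 * R) * Real.exp (γ s) ≤ I := by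
    have : ∫ s in (0 : ℝ)..1, (T s - s) ^ 2 / (2 * R) * Real.exp (γ s) ≤
        ∫ s in (0 : ℝ)..1, I := by
      apply intervalIntegral.integral_mono_on zero_le_one i1 (by simp)
      intro x hx
      exact weighted_sq_displacement_le hR hγc hc he hD hD0 hT hT0 hT1 hx
    simpa using this
  have h2 := integral_mul_deriv_exp hγ hD hT hT0 hT1
  have h3 : I = (∫ s in (0 : ℝ)..1, (D s - 1) * Real.exp (γ s)) -
      ∫ s in (0 : ℝ)..1, Real.log (D s) * Real.exp (γ s) := by
    rw [hI, ← intervalIntegral.integral_sub i4 i3]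
    congr 1; ext; ring
  simp only [add_mul]
  rw [intervalIntegral.integral_add (i1.add i2) i3, intervalIntegral.integral_add i1 i2]
  linarith

/-! ### Fubini on the cube and the Knothe map -/

theorem setIntegral_Icc_insertNth {n : ℕ} (i : Fin (n + 1)) {F : (Fin (n + 1) → ℝ) → ℝ}
    (hF : IntegrableOn F (Set.Icc 0 1)) :
    ∫ x in Set.Icc (0 : Fin (n + 1) → ℝ) 1, F x =
      ∫ x in Set.Icc (0 : Fin n → ℝ) 1, ∫ s in (0 : ℝ)..1, F (i.insertNth s x) := by
  have hmp := (volume_preserving_piFinSuccAbove (fun _ : Fin (n + 1) => ℝ) i).symm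
  set e := (MeasurableEquiv.piFinSuccAbove (fun _ : Fin (n + 1) => ℝ) i).symm with he
  have hpre : e ⁻¹' (Set.Icc 0 1) = Set.Icc (0 : ℝ) 1 ×ˢ Set.Icc (0 : Fin n → ℝ) 1 := by
    ext ⟨s, x⟩
    simp only [he, MeasurableEquiv.piFinSuccAbove_symm_apply, Set.mem_preimage, Set.mem_prod,
      Set.mem_Icc, Pi.le_def, Fin.forall_iff_succAbove i]
    simp [Fin.insertNthEquiv]
    tauto
  have hint : IntegrableOn (fun p => F (e p)) (Set.Icc (0 : ℝ) 1 ×ˢ Set.Icc (0 : Fin n → ℝ) 1)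
      (volume.prod volume) := by
    rw [← hpre]
    exact (hmp.integrableOn_comp_preimage e.measurableEmbedding).2 hF
  rw [← hmp.setIntegral_preimage_emb e.measurableEmbedding, hpre, Measure.volume_eq_prod]
  have hint' := hint.swap
  rw [← setIntegral_prod_swap]
  refine (setIntegral_prod _ hint').trans ?_
  apply setIntegral_congr_fun measurableSet_Icc
  intro x _
  simp only
  rw [intervalIntegral.integral_of_le zero_le_one, integral_Icc_eq_integral_Ioc]
  rfl

/-- Continuous dependence on the parameters of the inverse of a primitive. -/
theorem exists_continuous_inverse_primitive {X : Type*} [TopologicalSpace X]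
    [FirstCountableTopology X] {k : X → ℝ → ℝ} (hk : Continuous (Function.uncurry k)) {m : ℝ}
    (hm : 0 < m) (hmk : ∀ x s, m ≤ k x s) :
    ∃ J : X × ℝ → ℝ, Continuous J ∧ (∀ x c, ∫ s in (0 : ℝ)..J (x, c), k x s = c) ∧
      (∀ x t, J (x, ∫ s in (0 : ℝ)..t, k x s) = t) ∧
      ∀ x c, HasDerivAt (fun c => J (x, c)) (k x (J (x, c)))⁻¹ c := by
  have hkx : ∀ x, Continuous (k x) := fun x => hk.comp (Continuous.prodMk_right x)
  set G : X → ℝ → ℝ := fun x t => ∫ s in (0 : ℝ)..t, k x s with hG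
  have hGc : Continuous (Function.uncurry G) :=
    intervalIntegral.continuous_parametric_primitive_of_continuous hk
  have hGd : ∀ x t, HasDerivAt (G x) (k x t) t := fun x t =>
    intervalIntegral.integral_hasDerivAt_right ((hkx x).intervalIntegrable _ _)
      ((hkx x).stronglyMeasurableAtFilter _ _) (hkx x).continuousAt
  have hgrow : ∀ x s t, s ≤ t → m * (t - s) ≤ G x t - G x s := by
    intro x s t hst
    rw [hG, intervalIntegral.integral_interval_sub_left ((hkx x).intervalIntegrable _ _)
      ((hkx x).intervalIntegrable _ _)]
    have : ∫ _ in s..t, m ≤ ∫ y in s..t, k x y :=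
      intervalIntegral.integral_mono_on hst (by simp) ((hkx x).intervalIntegrable _ _)
        fun y _ => hmk x y
    simpa [mul_comm] using this
  -- Expansion by at least `m` makes each `G x` injective and reduces joint continuity of the
  -- inverse to continuity of `G`.
  have habs : ∀ x s t, m * |t - s| ≤ |G x t - G x s| := by
    intro x s t
    rcases le_total s t with h | h
    · rw [abs_of_nonneg (sub_nonneg.2 h)]; exact (hgrow x s t h).trans (le_abs_self _)
    · rw [abs_sub_comm, abs_of_nonneg (sub_nonneg.2 h), abs_sub_comm]
      exact (hgrow x t s h).trans (le_abs_self _)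
  have hG0 : ∀ x, G x 0 = 0 := fun x => by simp [hG]
  have hsurj : ∀ x, Function.Surjective (G x) := by
    intro x
    apply Continuous.surjective (hGc.comp (Continuous.prodMk_right x))
    · refine Filter.tendsto_atTop_mono' _ ?_ (Filter.tendsto_id.const_mul_atTop hm)
      filter_upwards [Filter.eventually_ge_atTop 0] with t ht
      simpa [hG0] using hgrow x 0 t ht
    · refine Filter.tendsto_atBot_mono' _ ?_ (Filter.tendsto_id.const_mul_atBot hm)
      filter_upwards [Filter.eventually_le_atBot 0] with t ht
      simpa [hG0] using hgrow x t 0 ht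
  choose J0 hJ0 using hsurj
  have hinj : ∀ x s t, G x s = G x t → s = t := by
    intro x s t h
    have := habs x s t
    rw [h, sub_self, abs_zero] at this
    have h2 : |t - s| ≤ 0 := by nlinarith
    linarith [abs_nonpos_iff.1 h2]
  have hJc : Continuous (fun p : X × ℝ => J0 p.1 p.2) := by
    rw [continuous_iff_continuousAt]
    rintro ⟨x0, c0⟩
    rw [ContinuousAt, tendsto_iff_dist_tendsto_zero]
    have h1 : Filter.Tendsto (fun p : X × ℝ => |p.2 - G p.1 (J0 x0 c0)| / m) (nhds (x0, c0))
        (nhds 0) := by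
      have : Continuous (fun p : X × ℝ => |p.2 - G p.1 (J0 x0 c0)| / m) := by
        have : Continuous fun p : X × ℝ => G p.1 (J0 x0 c0) :=
          hGc.comp (continuous_fst.prodMk continuous_const)
        fun_prop
      convert this.tendsto (x0, c0) using 2
      simp [hJ0]
    refine squeeze_zero (fun _ => dist_nonneg) (fun p => ?_) h1
    rw [Real.dist_eq, le_div_iff₀' hm]
    simpa [hJ0] using habs p.1 (J0 x0 c0) (J0 p.1 p.2)
  refine ⟨fun p => J0 p.1 p.2, hJc, hJ0, fun x t => hinj x _ _ (hJ0 x _), fun x c => ?_⟩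
  exact HasDerivAt.of_local_left_inverse (f := G x)
    (hJc.comp (Continuous.prodMk_right x)).continuousAt (hGd x _)
    (hm.trans_le (hmk _ _)).ne' (Filter.Eventually.of_forall fun c => hJ0 x c)

/-- The Knothe rearrangement of the density `ρ` to the density `σ` on the unit cube. -/
theorem exists_knothe_map (n : ℕ) : ∀ (ρ σ : (Fin n → ℝ) → ℝ), Continuous ρ → Continuous σ →
    ∀ m : ℝ, 0 < m → (∀ x, m ≤ ρ x) → (∀ x, m ≤ σ x) →
    ∃ (T : (Fin n → ℝ) → Fin n → ℝ) (D : Fin n → (Fin n → ℝ) → ℝ),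
      Continuous T ∧ (∀ i, Continuous (D i)) ∧ (∀ i x, 0 < D i x) ∧
      (∀ i x t, HasDerivAt (fun s => T (Function.update x i s) i)
        (D i (Function.update x i t)) t) ∧
      (∀ x i, x i = 0 → T x i = 0) ∧ (∀ x i, x i = 1 → T x i = 1) ∧
      ∀ x, σ (T x) * (∏ i, D i x) * ∫ y in Set.Icc 0 1, ρ y = ρ x * ∫ y in Set.Icc 0 1, σ y := by
  induction n with
  | zero =>
    intro ρ σ _ _ m _ _ _
    refine ⟨id, fun i => i.elim0, continuous_id, fun i => i.elim0, fun i => i.elim0,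
      fun i => i.elim0, fun _ i => i.elim0, fun _ i => i.elim0, fun x => ?_⟩
    -- In dimension zero the cube is one point of volume `1`.
    have h : ∀ g : (Fin 0 → ℝ) → ℝ, ∫ y in Set.Icc 0 1, g y = g x := by
      intro g
      have : g = fun _ => g x := funext fun y => congrArg g (Subsingleton.elim _ _)
      rw [this, setIntegral_const, measureReal_def, Real.volume_Icc_pi]
      simp
    rw [h, h]; simp [mul_comm]
  | succ n ih =>
    intro ρ σ hρ hσ m hm hmρ hmσ
    have hsn : Continuous (fun p : (Fin n → ℝ) × ℝ => (Fin.snoc p.1 p.2 : Fin (n + 1) → ℝ)) := by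
      refine continuous_pi fun j => ?_
      refine Fin.lastCases ?_ (fun j => ?_) j
      · simpa using continuous_snd
      · simp only [Fin.snoc_castSucc]; fun_prop
    have hinit : Continuous (fun x : Fin (n + 1) → ℝ => (Fin.init x : Fin n → ℝ)) :=
      continuous_pi fun j => continuous_apply j.castSucc
    -- The marginal keeps the lower bound `m` because the fibres have length `1`; this lets the
    -- induction run.
    have hmarg : ∀ g : (Fin (n + 1) → ℝ) → ℝ, Continuous g → (∀ x, m ≤ g x) →
        Continuous (fun x : Fin n → ℝ => ∫ s in (0 : ℝ)..1, g (Fin.snoc x s)) ∧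
        (∀ x : Fin n → ℝ, m ≤ ∫ s in (0 : ℝ)..1, g (Fin.snoc x s)) ∧
        ∫ y in Set.Icc 0 1, g y =
          ∫ x in Set.Icc (0 : Fin n → ℝ) 1, ∫ s in (0 : ℝ)..1, g (Fin.snoc x s) := by
      intro g hg hmg
      have hc : Continuous (Function.uncurry fun (x : Fin n → ℝ) (s : ℝ) => g (Fin.snoc x s)) :=
        hg.comp hsn
      refine ⟨intervalIntegral.continuous_parametric_intervalIntegral_of_continuous' hc 0 1,
        fun x => ?_, ?_⟩
      · have : ∫ _ in (0 : ℝ)..1, m ≤ ∫ s in (0 : ℝ)..1, g (Fin.snoc x s) :=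
          intervalIntegral.integral_mono_on zero_le_one (by simp)
            ((hc.comp (Continuous.prodMk_right x)).intervalIntegrable _ _) fun y _ => hmg _
        simpa using this
      · rw [setIntegral_Icc_insertNth (Fin.last n) (hg.continuousOn.integrableOn_compact isCompact_Icc)]
        simp only [Fin.insertNth_last']
    obtain ⟨hρ'c, hρ'm, hρ'i⟩ := hmarg ρ hρ hmρ
    obtain ⟨hσ'c, hσ'm, hσ'i⟩ := hmarg σ hσ hmσ
    set ρ' : (Fin n → ℝ) → ℝ := fun x => ∫ s in (0 : ℝ)..1, ρ (Fin.snoc x s) with hρ'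
    set σ' : (Fin n → ℝ) → ℝ := fun x => ∫ s in (0 : ℝ)..1, σ (Fin.snoc x s) with hσ'
    obtain ⟨T, D, hT, hD, hD0, hTD, hT0, hT1, hid⟩ := ih ρ' σ' hρ'c hσ'c m hm hρ'm hσ'm
    have hρk : Continuous (Function.uncurry fun (x : Fin n → ℝ) (s : ℝ) => ρ (Fin.snoc x s)) :=
      hρ.comp hsn
    obtain ⟨J, hJ, hJr, hJl, hJd⟩ := exists_continuous_inverse_primitive
      (k := fun (x : Fin n → ℝ) (s : ℝ) => σ (Fin.snoc x s)) (hσ.comp hsn) hm (fun _ _ => hmσ _)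
    set F : (Fin n → ℝ) × ℝ → ℝ := fun p => ∫ s in (0 : ℝ)..p.2, ρ (Fin.snoc p.1 s) with hF
    have hFc : Continuous F :=
      intervalIntegral.continuous_parametric_primitive_of_continuous hρk
    have hρ'0 : ∀ x, ρ' x ≠ 0 := fun x => (hm.trans_le (hρ'm x)).ne'
    have hσ0 : ∀ x, σ x ≠ 0 := fun x => (hm.trans_le (hmσ x)).ne'
    set r : (Fin n → ℝ) → ℝ := fun x => σ' (T x) / ρ' x with hr
    have hrc : Continuous r := (hσ'c.comp hT).div hρ'c hρ'0
    have hr0 : ∀ x, 0 < r x := fun x =>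
      div_pos (hm.trans_le (hσ'm _)) (hm.trans_le (hρ'm x))
    -- The last coordinate matches conditional distribution functions: the primitive of `σ` on the
    -- fibre over `T (Fin.init x)`, taken up to `S x`, equals that of `ρ` rescaled by the ratio `r`
    -- of the marginals.
    set S : (Fin (n + 1) → ℝ) → ℝ := fun x =>
      J (T (Fin.init x), F (Fin.init x, x (Fin.last n)) * r (Fin.init x)) with hS
    have hSc : Continuous S := by
      have hl : Continuous fun x : Fin (n + 1) → ℝ => x (Fin.last n) := continuous_apply _
      exact hJ.comp ((hT.comp hinit).prodMk
        ((hFc.comp (hinit.prodMk hl)).mul (hrc.comp hinit)))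
    set T1 : (Fin (n + 1) → ℝ) → Fin (n + 1) → ℝ := fun x => Fin.snoc (T (Fin.init x)) (S x)
      with hT1def
    have hT1c : Continuous T1 := hsn.comp ((hT.comp hinit).prodMk hSc)
    refine ⟨T1, Fin.snoc (fun i x => D i (Fin.init x)) (fun x => ρ x * r (Fin.init x) / σ (T1 x)),
      hT1c, ?_, ?_, ?_, ?_, ?_, ?_⟩
    · intro i
      refine Fin.lastCases ?_ (fun i => ?_) i
      · simp only [Fin.snoc_last]
        exact (hρ.mul (hrc.comp hinit)).div (hσ.comp hT1c) fun x => hσ0 _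
      · simp only [Fin.snoc_castSucc]; exact (hD i).comp hinit
    · intro i x
      refine Fin.lastCases ?_ (fun i => ?_) i
      · simp only [Fin.snoc_last]
        have h1 := hm.trans_le (hmρ x)
        have h2 := hm.trans_le (hmσ (T1 x))
        have h3 := hr0 (Fin.init x)
        positivity
      · simpa using hD0 i _
    · intro i x t
      refine Fin.lastCases ?_ (fun i => ?_) i
      · simp only [Fin.snoc_last, hT1def, hS, Fin.init_update_last, Function.update_self]
        have hFd : HasDerivAt (fun s => F (Fin.init x, s)) (ρ (Fin.snoc (Fin.init x) t)) t := by
          have hcx : Continuous fun s : ℝ => ρ (Fin.snoc (Fin.init x) s) :=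
            hρk.comp (Continuous.prodMk_right (Fin.init x))
          exact intervalIntegral.integral_hasDerivAt_right (hcx.intervalIntegrable _ _)
            (hcx.stronglyMeasurableAtFilter _ _) hcx.continuousAt
        have hup : Function.update x (Fin.last n) t = Fin.snoc (Fin.init x) t := by
          conv_lhs => rw [← Fin.snoc_init_self x]
          rw [Fin.update_snoc_last]
        have := (hJd (T (Fin.init x)) (F (Fin.init x, t) * r (Fin.init x))).comp t
          (hFd.mul_const (r (Fin.init x)))
        refine HasDerivAt.congr_deriv this ?_
        rw [hup, div_eq_inv_mul]
      · simp only [hT1def, Fin.snoc_castSucc, Fin.init_update_castSucc]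
        exact hTD i (Fin.init x) t
    · intro x i
      refine Fin.lastCases ?_ (fun i => ?_) i
      · intro h
        have := hJl (T (Fin.init x)) 0
        simp only [intervalIntegral.integral_same] at this
        simp [hT1def, hS, h, hF, this]
      · intro h
        simpa [hT1def] using hT0 (Fin.init x) i h
    · intro x i
      refine Fin.lastCases ?_ (fun i => ?_) i
      · intro h
        simp only [hT1def, hS, h, Fin.snoc_last]
        have h1 : F (Fin.init x, 1) * r (Fin.init x) = σ' (T (Fin.init x)) := by
          change ρ' (Fin.init x) * (σ' (T (Fin.init x)) / ρ' (Fin.init x)) = _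
          field_simp [hρ'0]
        rw [h1]
        exact hJl _ _
      · intro h
        simpa [hT1def] using hT1 (Fin.init x) i h
    · intro x
      rw [Fin.prod_univ_castSucc, hρ'i, hσ'i]
      simp only [Fin.snoc_castSucc, Fin.snoc_last]
      have := hid (Fin.init x)
      have h1 := hσ0 (T1 x)
      have h2 := hρ'0 (Fin.init x)
      calc _ = ρ x / ρ' (Fin.init x) * (σ' (T (Fin.init x)) * (∏ i, D i (Fin.init x)) *
            ∫ y in Set.Icc 0 1, ρ' y) := by
            simp only [hr]; field_simp
        _ = _ := by rw [this]; field_simp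

/-! ### The transportation-entropy inequality on the cube -/

theorem ConcaveOn.le_add_fderiv {E : Type*} [NormedAddCommGroup E] [NormedSpace ℝ E] {g : E → ℝ}
    (hc : ConcaveOn ℝ Set.univ g) {x : E} (hx : DifferentiableAt ℝ g x) (y : E) :
    g y ≤ g x + fderiv ℝ g x (y - x) := by
  have h1 : ConcaveOn ℝ Set.univ (g ∘ AffineMap.lineMap (k := ℝ) x y) :=
    hc.comp_affineMap (AffineMap.lineMap x y)
  have h2 : HasDerivAt (g ∘ AffineMap.lineMap (k := ℝ) x y) (fderiv ℝ g x (y - x)) 0 := by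
    have h3 : HasFDerivAt g (fderiv ℝ g x) (AffineMap.lineMap (k := ℝ) x y 0) := by
      simpa using hx.hasFDerivAt
    exact h3.comp_hasDerivAt 0 AffineMap.hasDerivAt_lineMap
  have h4 := h1.slope_le_of_hasDerivAt (Set.mem_univ 0) (Set.mem_univ 1) zero_lt_one h2
  simp [slope_def_field] at h4
  rw [map_sub]
  linarith

theorem fderiv_apply_eq_sum_lineDeriv {n : ℕ} {g : (Fin n → ℝ) → ℝ} {x : Fin n → ℝ}
    (hx : DifferentiableAt ℝ g x) (v : Fin n → ℝ) :
    fderiv ℝ g x v = ∑ i, lineDeriv ℝ g x (Pi.single i 1) * v i := by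
  conv_lhs => rw [pi_eq_sum_univ' v]
  simp [hx.lineDeriv_eq_fderiv, mul_comm]

theorem lineDeriv_update_eq_deriv {n : ℕ} (g : (Fin n → ℝ) → ℝ) (x : Fin n → ℝ) (i : Fin n)
    (s : ℝ) : lineDeriv ℝ g (Function.update x i s) (Pi.single i 1) =
      deriv (fun t => g (Function.update x i t)) s := by
  have h : ∀ t, Function.update x i s + t • Pi.single i 1 = Function.update x i (s + t) := by
    intro t; ext j
    by_cases hj : j = i
    · subst hj; simp
    · simp [hj]
  simp only [lineDeriv, h]
  rw [deriv_comp_const_add (f := fun t => g (Function.update x i t)) s 0, add_zero]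

theorem LipschitzWith.comp_update {n : ℕ} {g : (Fin n → ℝ) → ℝ} {C : NNReal}
    (hg : LipschitzWith C g) (x : Fin n → ℝ) (i : Fin n) :
    LipschitzWith C (fun t => g (Function.update x i t)) := by
  have h : LipschitzWith 1 (fun t => Function.update x i t) := by
    refine LipschitzWith.of_dist_le_mul fun s t => ?_
    rw [NNReal.coe_one, one_mul, dist_pi_le_iff dist_nonneg]
    intro j
    by_cases hj : j = i
    · subst hj; simp
    · simp [hj]
  have := hg.comp h
  rwa [mul_one] at this

theorem ConcaveOn.comp_update {n : ℕ} {g : (Fin n → ℝ) → ℝ} (hg : ConcaveOn ℝ Set.univ g)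
    (x : Fin n → ℝ) (i : Fin n) : ConcaveOn ℝ Set.univ (fun t => g (Function.update x i t)) := by
  refine ⟨convex_univ, fun s _ t _ a b ha hb hab => ?_⟩
  have h : Function.update x i (a • s + b • t) =
      a • Function.update x i s + b • Function.update x i t := by
    ext j
    by_cases hj : j = i
    · subst hj; simp
    · simp [hj, ← add_mul, hab]
  simp only [h]
  exact hg.2 (Set.mem_univ _) (Set.mem_univ _) ha hb hab

theorem update_mem_Icc {n : ℕ} {x : Fin n → ℝ} (hx : x ∈ Set.Icc (0 : Fin n → ℝ) 1) (i : Fin n)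
    {s : ℝ} (hs : s ∈ Set.Icc (0 : ℝ) 1) :
    Function.update x i s ∈ Set.Icc (0 : Fin n → ℝ) 1 := by
  constructor <;> intro j <;> by_cases hj : j = i
  · subst hj; simpa using hs.1
  · simpa [hj] using hx.1 j
  · subst hj; simpa using hs.2
  · simpa [hj] using hx.2 j

/-- The value of `ρ` at each point of the unit cube is at most `R` times the maximum of its
values at the end points of every segment of the cube through this point in a coordinate
direction. -/
def BoundedByFaces {n : ℕ} (R : ℝ) (ρ : (Fin n → ℝ) → ℝ) : Prop :=
  ∀ x ∈ Set.Icc (0 : Fin n → ℝ) 1, ∀ i,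
    ρ x ≤ R * max (ρ (Function.update x i 0)) (ρ (Function.update x i 1))

theorem integrableOn_displacement_term {n : ℕ} {R : ℝ} {C : NNReal} {g : (Fin n → ℝ) → ℝ}
    (hg : LipschitzWith C g) {T : (Fin n → ℝ) → Fin n → ℝ} {D : (Fin n → ℝ) → ℝ}
    (hT : Continuous T) (hD : Continuous D) (hD0 : ∀ x, 0 < D x) (i : Fin n) :
    IntegrableOn (fun x => ((T x i - x i) ^ 2 / (2 * R) +
      lineDeriv ℝ g x (Pi.single i 1) * (T x i - x i) + Real.log (D x)) * Real.exp (g x))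
      (Set.Icc 0 1) := by
  have hgc := hg.continuous
  have hTi : Continuous fun x => T x i := (continuous_apply i).comp hT
  have hlog : Continuous fun x => Real.log (D x) := hD.log fun x => (hD0 x).ne'
  have h1 : IntegrableOn (fun x => ((T x i - x i) ^ 2 / (2 * R) + Real.log (D x)) *
      Real.exp (g x)) (Set.Icc 0 1) :=
    Continuous.integrableOn_Icc (by fun_prop)
  have h2 : IntegrableOn (fun x => lineDeriv ℝ g x (Pi.single i 1) * ((T x i - x i) *
      Real.exp (g x))) (Set.Icc 0 1) := by
    refine Integrable.bdd_mul (c := C * ‖(Pi.single i 1 : Fin n → ℝ)‖) ?_ ?_ ?_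
    · exact Continuous.integrableOn_Icc (by fun_prop)
    · exact (measurable_lineDeriv hgc).aestronglyMeasurable
    · exact Filter.Eventually.of_forall fun x => norm_lineDeriv_le_of_lipschitz ℝ hg
  refine (h1.add h2).congr_fun (fun x _ => ?_) measurableSet_Icc
  simp only [Pi.add_apply]; ring

/-- On each line in direction `i`, `T_i` is an increasing map of `[0, 1]` fixing its end points, so
the one-dimensional inequality applies; Fubini adds up the lines. -/
theorem integral_displacement_term_nonpos {n : ℕ} {R : ℝ} (hR : 1 ≤ R) {C : NNReal}
    {g : (Fin n → ℝ) → ℝ} (hg : LipschitzWith C g) (hc : ConcaveOn ℝ Set.univ g)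
    (he : BoundedByFaces R fun x => Real.exp (g x)) {T : (Fin n → ℝ) → Fin n → ℝ}
    {D : (Fin n → ℝ) → ℝ} (hT : Continuous T) (hD : Continuous D) (hD0 : ∀ x, 0 < D x)
    (i : Fin n)
    (hTD : ∀ x t, HasDerivAt (fun s => T (Function.update x i s) i) (D (Function.update x i t)) t)
    (hT0 : ∀ x, x i = 0 → T x i = 0) (hT1 : ∀ x, x i = 1 → T x i = 1) :
    ∫ x in Set.Icc 0 1, ((T x i - x i) ^ 2 / (2 * R) +
      lineDeriv ℝ g x (Pi.single i 1) * (T x i - x i) + Real.log (D x)) * Real.exp (g x) ≤ 0 := by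
  cases n with
  | zero => exact i.elim0
  | succ n =>
    rw [setIntegral_Icc_insertNth i (integrableOn_displacement_term hg hT hD hD0 i)]
    refine setIntegral_nonpos measurableSet_Icc fun y hy => ?_
    set x : Fin (n + 1) → ℝ := i.insertNth (0 : ℝ) y with hx
    have hup : ∀ s : ℝ, i.insertNth s y = Function.update x i s := fun s => by
      rw [hx, Fin.update_insertNth]
    have hxm : x ∈ Set.Icc (0 : Fin (n + 1) → ℝ) 1 := by
      simp only [Set.mem_Icc, Pi.le_def, Fin.forall_iff_succAbove i, hx]
      simpa using ⟨fun j => hy.1 j, fun j => hy.2 j⟩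
    simp only [hup, Function.update_self, lineDeriv_update_eq_deriv]
    have hupc : Continuous fun s : ℝ => Function.update x i s :=
      continuous_const.update i continuous_id
    refine integral_line_le_zero hR (hg.comp_update x i) (hc.comp_update x i) ?_ (hD.comp hupc)
      (fun s => hD0 _) (fun s => hTD x s) (hT0 _ (by simp)) (hT1 _ (by simp))
    intro s hs
    simpa using he _ (update_mem_Icc hxm i hs) i

/-- The dual form of the transportation-entropy inequality for the density `exp g` on the unit
cube. -/
theorem integral_exp_add_le {n : ℕ} {R : ℝ} (hR : 1 ≤ R) {C : NNReal}
    {g : (Fin n → ℝ) → ℝ} (hg : LipschitzWith C g) (hc : ConcaveOn ℝ Set.univ g)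
    (he : BoundedByFaces R fun x => Real.exp (g x)) {p q : (Fin n → ℝ) → ℝ} (hp : Continuous p)
    (hq : Continuous q)
    (hpq : ∀ x ∈ Set.Icc (0 : Fin n → ℝ) 1, ∀ y ∈ Set.Icc (0 : Fin n → ℝ) 1,
      p x + q y ≤ ∑ i, (y i - x i) ^ 2 / (2 * R)) :
    ∫ x in Set.Icc (0 : Fin n → ℝ) 1, Real.exp (q x + g x) ≤
      (∫ x in Set.Icc (0 : Fin n → ℝ) 1, Real.exp (g x)) *
        Real.exp (-((∫ x in Set.Icc (0 : Fin n → ℝ) 1, p x * Real.exp (g x)) /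
          ∫ x in Set.Icc (0 : Fin n → ℝ) 1, Real.exp (g x))) := by
  have hgc := hg.continuous
  -- Clamping to the cube gives densities bounded below by a positive constant on the whole space,
  -- as the Knothe map requires, and changes nothing on the cube.
  set κ : (Fin n → ℝ) → Fin n → ℝ := fun x i => max 0 (min 1 (x i)) with hκ
  have hκc : Continuous κ := by fun_prop
  have hκm : ∀ x, κ x ∈ Set.Icc (0 : Fin n → ℝ) 1 := fun x =>
    ⟨fun i => le_max_left _ _, fun i => max_le zero_le_one (min_le_left _ _)⟩
  have hκe : ∀ x ∈ Set.Icc (0 : Fin n → ℝ) 1, κ x = x := fun x hx => funext fun i => by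
    have h0 : 0 ≤ x i := hx.1 i
    have h1 : x i ≤ 1 := hx.2 i
    simp [hκ, h0, h1]
  have hlow : ∀ h : (Fin n → ℝ) → ℝ, Continuous h → ∃ m : ℝ, ∀ x, m ≤ h (κ x) := by
    intro h hh
    obtain ⟨m, hm⟩ := (isCompact_Icc (a := (0 : Fin n → ℝ)) (b := 1)).bddBelow_image hh.continuousOn
    exact ⟨m, fun x => hm (Set.mem_image_of_mem _ (hκm x))⟩
  obtain ⟨m1, hm1⟩ := hlow g hgc
  obtain ⟨m2, hm2⟩ := hlow (fun x => q x + g x) (by fun_prop)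
  obtain ⟨T, D, hT, hD, hD0, hTD, hT0, hT1, hid⟩ := exists_knothe_map n
    (fun x => Real.exp (g (κ x))) (fun x => Real.exp (q (κ x) + g (κ x))) (by fun_prop)
    (by fun_prop) (Real.exp (min m1 m2)) (Real.exp_pos _)
    (fun x => Real.exp_le_exp.2 ((min_le_left _ _).trans (hm1 x)))
    (fun x => Real.exp_le_exp.2 ((min_le_right _ _).trans (hm2 x)))
  have hTm : ∀ x ∈ Set.Icc (0 : Fin n → ℝ) 1, T x ∈ Set.Icc (0 : Fin n → ℝ) 1 := by
    intro x hx
    have hmono : ∀ i, Monotone fun s => T (Function.update x i s) i := fun i =>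
      (strictMono_of_hasDerivAt_pos (hTD i x) fun t => hD0 _ _).monotone
    constructor <;> intro i
    · have := hmono i (hx.1 i)
      simpa [hT0 (Function.update x i 0) i (by simp)] using this
    · have := hmono i (hx.2 i)
      simpa [hT1 (Function.update x i 1) i (by simp)] using this
  have hcl : ∀ h : (Fin n → ℝ) → ℝ, ∫ x in Set.Icc (0 : Fin n → ℝ) 1, h (κ x) =
      ∫ x in Set.Icc (0 : Fin n → ℝ) 1, h x := fun h =>
    setIntegral_congr_fun measurableSet_Icc fun x hx => by simp only [hκe x hx]
  have hcl1 := hcl fun x => Real.exp (g x)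
  have hcl2 := hcl fun x => Real.exp (q x + g x)
  rw [hcl1, hcl2] at hid
  set Iρ := ∫ x in Set.Icc (0 : Fin n → ℝ) 1, Real.exp (g x) with hIρ
  set Iσ := ∫ x in Set.Icc (0 : Fin n → ℝ) 1, Real.exp (q x + g x) with hIσ
  have hposint : ∀ h : (Fin n → ℝ) → ℝ, Continuous h →
      0 < ∫ x in Set.Icc (0 : Fin n → ℝ) 1, Real.exp (h x) := by
    intro h hh
    rw [setIntegral_pos_iff_support_of_nonneg_ae
      (Filter.Eventually.of_forall fun x => (Real.exp_pos _).le)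
      (Continuous.integrableOn_Icc (by fun_prop))]
    have : Function.support (fun x => Real.exp (h x)) = Set.univ :=
      Set.eq_univ_of_forall fun x => (Real.exp_pos _).ne'
    rw [this, Set.univ_inter, Real.volume_Icc_pi]
    simp
  have hIρ0 : 0 < Iρ := hposint g hgc
  have hIσ0 : 0 < Iσ := hposint (fun x => q x + g x) (by fun_prop)
  set L := Real.log (Iσ / Iρ) with hL
  -- Logarithm of the Jacobian equation, the tangent inequality for the concave `g` (differentiable
  -- almost everywhere by Rademacher), and the cost bound on `p x + q (T x)`.
  have hpt : ∀ᵐ x ∂(volume.restrict (Set.Icc (0 : Fin n → ℝ) 1)),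
      (L + p x) * Real.exp (g x) ≤ ∑ i, ((T x i - x i) ^ 2 / (2 * R) +
        lineDeriv ℝ g x (Pi.single i 1) * (T x i - x i) + Real.log (D i x)) * Real.exp (g x) := by
    filter_upwards [ae_restrict_mem measurableSet_Icc, ae_restrict_of_ae hg.ae_differentiableAt]
      with x hx hdx
    rw [← Finset.sum_mul]
    refine mul_le_mul_of_nonneg_right ?_ (Real.exp_pos _).le
    have h1 := hid x
    rw [hκe x hx, hκe _ (hTm x hx)] at h1
    have hprod : 0 < ∏ i, D i x := Finset.prod_pos fun i _ => hD0 i x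
    have h2 : Iσ / Iρ = Real.exp (q (T x) + g (T x)) * (∏ i, D i x) / Real.exp (g x) := by
      rw [div_eq_div_iff hIρ0.ne' (Real.exp_pos _).ne', h1]; ring
    have h3 : L = q (T x) + g (T x) - g x + ∑ i, Real.log (D i x) := by
      rw [hL, h2, Real.log_div (mul_pos (Real.exp_pos _) hprod).ne' (Real.exp_pos _).ne',
        Real.log_mul (Real.exp_pos _).ne' hprod.ne', Real.log_exp, Real.log_exp,
        Real.log_prod fun i _ => (hD0 i x).ne']
      ring
    have h4 := hc.le_add_fderiv hdx (T x)
    rw [fderiv_apply_eq_sum_lineDeriv hdx] at h4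
    simp only [Pi.sub_apply] at h4
    have h5 := hpq x hx (T x) (hTm x hx)
    simp only [Finset.sum_add_distrib]
    linarith
  have hint : ∀ i, IntegrableOn (fun x => ((T x i - x i) ^ 2 / (2 * R) +
      lineDeriv ℝ g x (Pi.single i 1) * (T x i - x i) + Real.log (D i x)) * Real.exp (g x))
      (Set.Icc 0 1) := fun i => integrableOn_displacement_term hg hT (hD i) (hD0 i) i
  have i1 : IntegrableOn (fun x => L * Real.exp (g x)) (Set.Icc (0 : Fin n → ℝ) 1) :=
    Continuous.integrableOn_Icc (by fun_prop)
  have i2 : IntegrableOn (fun x => p x * Real.exp (g x)) (Set.Icc (0 : Fin n → ℝ) 1) :=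
    Continuous.integrableOn_Icc (by fun_prop)
  have h1 := integral_mono_ae (Continuous.integrableOn_Icc (by fun_prop))
    (integrable_finsetSum _ fun i _ => hint i) hpt
  rw [integral_finsetSum _ fun i _ => hint i] at h1
  simp only [add_mul] at h1
  rw [integral_add i1 i2, integral_const_mul] at h1
  have h2 : L * Iρ + ∫ x in Set.Icc (0 : Fin n → ℝ) 1, p x * Real.exp (g x) ≤ 0 := by
    refine h1.trans (Finset.sum_nonpos fun i _ => ?_)
    simp only [← add_mul]
    exact integral_displacement_term_nonpos hR hg hc he hT (hD i) (hD0 i) i (hTD i)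
      (fun x => hT0 x i) (fun x => hT1 x i)
  have h3 : L ≤ -((∫ x in Set.Icc (0 : Fin n → ℝ) 1, p x * Real.exp (g x)) / Iρ) := by
    rw [← neg_div, le_div_iff₀ hIρ0]; linarith
  have h4 := Real.exp_le_exp.2 h3
  rwa [hL, Real.exp_log (by positivity), div_le_iff₀' hIρ0] at h4

/-! ### Maurey's property for Lipschitz log-densities -/

/-- A function that is `1`-Lipschitz for the Euclidean distance. -/
def IsEuclideanShort {n : ℕ} (δ : (Fin n → ℝ) → ℝ) : Prop :=
  ∀ x y, δ x ≤ δ y + √(∑ i, (x i - y i) ^ 2)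

/-- Maurey's property for the density `exp g` on the unit cube and the distance to a set. -/
theorem integral_mul_integral_exp_sq_le {n : ℕ} {R : ℝ} (hR : 1 ≤ R) {C : NNReal}
    {g : (Fin n → ℝ) → ℝ} (hg : LipschitzWith C g) (hc : ConcaveOn ℝ Set.univ g)
    (he : BoundedByFaces R fun x => Real.exp (g x)) {δ : (Fin n → ℝ) → ℝ} (hδ : Continuous δ)
    (hδ0 : ∀ x, 0 ≤ δ x) (hδl : IsEuclideanShort δ) {A : Set (Fin n → ℝ)} (hA : MeasurableSet A)
    (hδA : ∀ x ∈ A, δ x = 0) :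
    (∫ x in A, Real.exp (g x) ∂(volume.restrict (Set.Icc 0 1))) *
        ∫ x in Set.Icc 0 1, Real.exp (δ x ^ 2 / (4 * R)) * Real.exp (g x) ≤
      (∫ x in Set.Icc 0 1, Real.exp (g x)) ^ 2 := by
  have hgc := hg.continuous
  have hR0 : 0 < R := by linarith
  obtain ⟨M, hM⟩ := (isCompact_Icc (a := (0 : Fin n → ℝ)) (b := 1)).bddAbove_image
    hδ.continuousOn
  -- With `S = |x - y| ≤ √n` and `δ y ≤ M`, this gives `δ x ^ 2 ≤ (δ y + S) ^ 2 ≤ S ^ 2 + m * δ y`.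
  -- So `-m * δ`, which vanishes on `A`, is an admissible partner of `δ ^ 2 / (2 * R)`.
  set m := M + 2 * √(n : ℝ) with hm
  set I := ∫ x in Set.Icc (0 : Fin n → ℝ) 1, Real.exp (g x) with hI
  have hI0 : 0 ≤ I := integral_nonneg fun x => (Real.exp_pos _).le
  have hS : ∀ x y : Fin n → ℝ, √(∑ i, (x i - y i) ^ 2) ^ 2 = ∑ i, (x i - y i) ^ 2 := fun x y =>
    Real.sq_sqrt (Finset.sum_nonneg fun i _ => sq_nonneg _)
  have h1 : ∫ x in Set.Icc (0 : Fin n → ℝ) 1, Real.exp (-m * δ x + g x) ≤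
      I * Real.exp (-((∫ x in Set.Icc (0 : Fin n → ℝ) 1, δ x ^ 2 / (2 * R) * Real.exp (g x)) /
        I)) := by
    refine integral_exp_add_le hR hg hc he (by fun_prop) (by fun_prop) fun x hx y hy => ?_
    rw [← Finset.sum_div]
    have h2 := hδl x y
    have h3 : δ y ≤ M := hM (Set.mem_image_of_mem _ hy)
    have h4 : √(∑ i, (x i - y i) ^ 2) ≤ √(n : ℝ) := by
      apply Real.sqrt_le_sqrt
      calc ∑ i, (x i - y i) ^ 2 ≤ ∑ i : Fin n, (1 : ℝ) := by
            refine Finset.sum_le_sum fun i _ => ?_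
            have := hx.1 i; have := hx.2 i; have := hy.1 i; have := hy.2 i
            simp only [Pi.zero_apply, Pi.one_apply] at *
            rw [sq_le_one_iff_abs_le_one, abs_le]
            constructor <;> linarith
        _ = n := by simp
    have h5 := hS x y
    have h6 : ∑ i, (y i - x i) ^ 2 = ∑ i, (x i - y i) ^ 2 :=
      Finset.sum_congr rfl fun i _ => by ring
    rw [h6, ← h5]
    set S := √(∑ i, (x i - y i) ^ 2)
    have hS0 : 0 ≤ S := Real.sqrt_nonneg _
    have h7 : δ x ^ 2 ≤ (δ y + S) ^ 2 := by
      have := hδ0 x; gcongr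
    have h8 : δ y * (δ y + 2 * S) ≤ δ y * m := by
      have := hδ0 y
      gcongr
      linarith
    have hm0 : 0 ≤ δ y * m := (mul_nonneg (hδ0 y) (by linarith [hδ0 y])).trans h8
    have h9 : δ y * m ≤ 2 * R * (m * δ y) := by nlinarith
    rw [div_add' _ _ _ (by positivity)]
    gcongr
    nlinarith
  -- The opposite choice of `p`. The loss from `2 * R` to `4 * R` is that of `(a + b)^2 ≤ 2a^2 +
  -- 2b^2`.
  have h2 : ∫ x in Set.Icc (0 : Fin n → ℝ) 1, Real.exp (δ x ^ 2 / (4 * R) + g x) ≤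
      I * Real.exp (-((∫ x in Set.Icc (0 : Fin n → ℝ) 1, -(δ x ^ 2 / (2 * R)) *
        Real.exp (g x)) / I)) := by
    refine integral_exp_add_le hR hg hc he (by fun_prop) (by fun_prop) fun x _ y _ => ?_
    rw [← Finset.sum_div, ← hS y x]
    have h2 := hδl y x
    set S := √(∑ i, (y i - x i) ^ 2)
    have h7 : δ y ^ 2 ≤ (δ x + S) ^ 2 := by
      have := hδ0 y; gcongr
    have h8 : δ y ^ 2 / (4 * R) ≤ (2 * δ x ^ 2 + 2 * S ^ 2) / (4 * R) := by
      gcongr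
      nlinarith [sq_nonneg (δ x - S)]
    have h9 : (2 * δ x ^ 2 + 2 * S ^ 2) / (4 * R) = δ x ^ 2 / (2 * R) + S ^ 2 / (2 * R) := by
      field_simp; ring
    linarith
  have h3 : ∫ x in A, Real.exp (g x) ∂(volume.restrict (Set.Icc 0 1)) ≤
      ∫ x in Set.Icc (0 : Fin n → ℝ) 1, Real.exp (-m * δ x + g x) := by
    have hint : IntegrableOn (fun x => Real.exp (-m * δ x + g x)) (Set.Icc (0 : Fin n → ℝ) 1) :=
      Continuous.integrableOn_Icc (by fun_prop)
    calc ∫ x in A, Real.exp (g x) ∂(volume.restrict (Set.Icc 0 1))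
        = ∫ x in A, Real.exp (-m * δ x + g x) ∂(volume.restrict (Set.Icc 0 1)) :=
          setIntegral_congr_fun hA fun x hx => by simp [hδA x hx]
      _ ≤ _ := setIntegral_le_integral hint
          (Filter.Eventually.of_forall fun x => (Real.exp_pos _).le)
  simp only [neg_mul, integral_neg] at h2
  rw [neg_div, neg_neg] at h2
  simp only [← Real.exp_add]
  have h4 := mul_le_mul (h3.trans h1) h2 (integral_nonneg fun x => (Real.exp_pos _).le)
    (mul_nonneg hI0 (Real.exp_pos _).le)
  -- The two bounds contain opposite exponents, which cancel in the product.
  refine h4.trans (le_of_eq ?_)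
  rw [mul_mul_mul_comm, ← Real.exp_add, neg_add_cancel, Real.exp_zero, mul_one, sq]

/-- Maurey's property passes to dominated limits of densities. -/
theorem integral_mul_integral_le_of_tendsto {α : Type*} [MeasurableSpace α] {ν : Measure α}
    {ρs : ℕ → α → ℝ} {ρ B E : α → ℝ} {A : Set α} (hm : ∀ k, AEStronglyMeasurable (ρs k) ν)
    (hB : Integrable B ν) (hbd : ∀ k, ∀ᵐ x ∂ν, ‖ρs k x‖ ≤ B x)
    (hlim : ∀ᵐ x ∂ν, Filter.Tendsto (fun k => ρs k x) Filter.atTop (nhds (ρ x)))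
    (hE : AEStronglyMeasurable E ν) {c : ℝ} (hEc : ∀ᵐ x ∂ν, ‖E x‖ ≤ c)
    (h : ∀ k, (∫ x in A, ρs k x ∂ν) * ∫ x, E x * ρs k x ∂ν ≤ (∫ x, ρs k x ∂ν) ^ 2) :
    (∫ x in A, ρ x ∂ν) * ∫ x, E x * ρ x ∂ν ≤ (∫ x, ρ x ∂ν) ^ 2 := by
  have h1 : Filter.Tendsto (fun k => ∫ x in A, ρs k x ∂ν) Filter.atTop
      (nhds (∫ x in A, ρ x ∂ν)) :=
    tendsto_integral_of_dominated_convergence B (fun k => (hm k).restrict) hB.restrict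
      (fun k => ae_restrict_of_ae (hbd k)) (ae_restrict_of_ae hlim)
  have h2 : Filter.Tendsto (fun k => ∫ x, ρs k x ∂ν) Filter.atTop (nhds (∫ x, ρ x ∂ν)) :=
    tendsto_integral_of_dominated_convergence B hm hB hbd hlim
  have h3 : Filter.Tendsto (fun k => ∫ x, E x * ρs k x ∂ν) Filter.atTop
      (nhds (∫ x, E x * ρ x ∂ν)) := by
    refine tendsto_integral_of_dominated_convergence (fun x => c * B x)
      (fun k => hE.mul (hm k)) (hB.const_mul c) (fun k => ?_) ?_
    · filter_upwards [hbd k, hEc] with x h1 h2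
      rw [norm_mul]
      exact mul_le_mul h2 h1 (norm_nonneg _) ((norm_nonneg _).trans h2)
    · filter_upwards [hlim] with x hx using hx.const_mul _
  exact le_of_tendsto_of_tendsto' (h1.mul h3) (h2.pow 2) h

/-! ### Lipschitz regularization of concave functions -/

/-- The sup-convolution of a function `ℓ` on `D` with `-k` times the `ℓ¹`-norm. -/
noncomputable def supConvolution {n : ℕ} (D : Set (Fin n → ℝ)) (ℓ : (Fin n → ℝ) → ℝ) (k : ℝ)
    (x : Fin n → ℝ) : ℝ :=
  ⨆ y : D, (ℓ y - k * ∑ i, |x i - y.1 i|)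

section SupConvolution

variable {n : ℕ} {D : Set (Fin n → ℝ)} {ℓ : (Fin n → ℝ) → ℝ} {k c : ℝ}

theorem le_supConvolution (hℓ : ∀ y ∈ D, ℓ y ≤ c) (hk : 0 ≤ k) (x : Fin n → ℝ) {y : Fin n → ℝ}
    (hy : y ∈ D) : ℓ y - k * ∑ i, |x i - y i| ≤ supConvolution D ℓ k x := by
  refine le_ciSup (f := fun y : D => ℓ y - k * ∑ i, |x i - y.1 i|) ⟨c, ?_⟩ ⟨y, hy⟩
  rintro _ ⟨y, rfl⟩
  have : 0 ≤ k * ∑ i, |x i - y.1 i| := by positivity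
  simp only
  linarith [hℓ y y.2]

theorem supConvolution_le (hD : D.Nonempty) {x : Fin n → ℝ} {b : ℝ}
    (h : ∀ y ∈ D, ℓ y - k * ∑ i, |x i - y i| ≤ b) : supConvolution D ℓ k x ≤ b := by
  have := hD.to_subtype
  exact ciSup_le fun y => h y y.2

theorem supConvolution_le_bound (hD : D.Nonempty) (hℓ : ∀ y ∈ D, ℓ y ≤ c) (hk : 0 ≤ k)
    (x : Fin n → ℝ) : supConvolution D ℓ k x ≤ c := by
  refine supConvolution_le hD fun y hy => ?_
  have : 0 ≤ k * ∑ i, |x i - y i| := by positivity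
  linarith [hℓ y hy]

theorem le_supConvolution_self (hℓ : ∀ y ∈ D, ℓ y ≤ c) (hk : 0 ≤ k) {x : Fin n → ℝ}
    (hx : x ∈ D) : ℓ x ≤ supConvolution D ℓ k x := by
  simpa using le_supConvolution hℓ hk x hx

theorem lipschitzWith_supConvolution (hD : D.Nonempty) (hℓ : ∀ y ∈ D, ℓ y ≤ c) (hk : 0 ≤ k) :
    LipschitzWith (k * n).toNNReal (supConvolution D ℓ k) := by
  refine LipschitzWith.of_le_add_mul _ fun x x' => ?_
  rw [Real.coe_toNNReal _ (by positivity)]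
  refine supConvolution_le hD fun y hy => ?_
  have h1 := le_supConvolution hℓ hk x' hy
  have h2 : ∑ i, |x' i - y i| ≤ n * dist x x' + ∑ i, |x i - y i| := by
    calc ∑ i, |x' i - y i| ≤ ∑ i, (dist x x' + |x i - y i|) := by
          refine Finset.sum_le_sum fun i _ => ?_
          have h3 := dist_le_pi_dist x x' i
          rw [Real.dist_eq, abs_sub_comm] at h3
          linarith [abs_sub_le (x' i) (x i) (y i)]
      _ = _ := by simp [Finset.sum_add_distrib]
  nlinarith [mul_le_mul_of_nonneg_left h2 hk]

/-- The expression under the supremum is jointly concave in `x` and `y`, and a partial supremum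
preserves concavity. -/
theorem concaveOn_supConvolution (hD : D.Nonempty) (hℓ : ∀ y ∈ D, ℓ y ≤ c) (hk : 0 ≤ k)
    (hc : ConcaveOn ℝ D ℓ) : ConcaveOn ℝ Set.univ (supConvolution D ℓ k) := by
  rw [concaveOn_iff_forall_pos]
  refine ⟨convex_univ, fun x _ x' _ a b ha hb hab => ?_⟩
  simp only [smul_eq_mul]
  have key : ∀ y ∈ D, ∀ y' ∈ D, a * (ℓ y - k * ∑ i, |x i - y i|) +
      b * (ℓ y' - k * ∑ i, |x' i - y' i|) ≤ supConvolution D ℓ k (a • x + b • x') := by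
    intro y hy y' hy'
    have h1 := le_supConvolution hℓ hk (a • x + b • x') (hc.1 hy hy' ha.le hb.le hab)
    have h2 := hc.2 hy hy' ha.le hb.le hab
    simp only [smul_eq_mul] at h2
    have h3 : ∑ i, |(a • x + b • x') i - (a • y + b • y') i| ≤
        a * ∑ i, |x i - y i| + b * ∑ i, |x' i - y' i| := by
      rw [Finset.mul_sum, Finset.mul_sum, ← Finset.sum_add_distrib]
      refine Finset.sum_le_sum fun i _ => ?_
      have h4 : (a • x + b • x') i - (a • y + b • y') i = a * (x i - y i) + b * (x' i - y' i) := by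
        simp only [Pi.add_apply, Pi.smul_apply, smul_eq_mul]; ring
      rw [h4]
      refine (abs_add_le _ _).trans (le_of_eq ?_)
      rw [abs_mul, abs_mul, abs_of_pos ha, abs_of_pos hb]
    nlinarith [mul_le_mul_of_nonneg_left h3 hk]
  have h1 : ∀ y' ∈ D, a * supConvolution D ℓ k x + b * (ℓ y' - k * ∑ i, |x' i - y' i|) ≤
      supConvolution D ℓ k (a • x + b • x') := by
    intro y' hy'
    have : supConvolution D ℓ k x ≤ (supConvolution D ℓ k (a • x + b • x') -
        b * (ℓ y' - k * ∑ i, |x' i - y' i|)) / a :=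
      supConvolution_le hD fun y hy => by rw [le_div_iff₀' ha]; linarith [key y hy y' hy']
    rw [le_div_iff₀' ha] at this
    linarith
  have : supConvolution D ℓ k x' ≤ (supConvolution D ℓ k (a • x + b • x') -
      a * supConvolution D ℓ k x) / b :=
    supConvolution_le hD fun y hy => by rw [le_div_iff₀' hb]; linarith [h1 y hy]
  rw [le_div_iff₀' hb] at this
  linarith

theorem dist_le_sum_abs (x y : Fin n → ℝ) : dist x y ≤ ∑ i, |x i - y i| := by
  rw [dist_pi_le_iff (Finset.sum_nonneg fun i _ => abs_nonneg _)]
  intro i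
  rw [Real.dist_eq]
  exact Finset.single_le_sum (f := fun i => |x i - y i|) (fun i _ => abs_nonneg _)
    (Finset.mem_univ i)

theorem tendsto_supConvolution_of_continuousAt (hℓ : ∀ y ∈ D, ℓ y ≤ c) {x : Fin n → ℝ}
    (hx : x ∈ D) (hcont : ContinuousWithinAt ℓ D x) :
    Filter.Tendsto (fun k : ℕ => supConvolution D ℓ k x) Filter.atTop (nhds (ℓ x)) := by
  rw [Metric.tendsto_atTop]
  intro ε hε
  obtain ⟨r, hr, hr'⟩ := Metric.continuousWithinAt_iff.1 hcont (ε / 2) (by positivity)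
  obtain ⟨N, hN⟩ := exists_nat_ge ((c - ℓ x) / r)
  refine ⟨N, fun k hk => ?_⟩
  have hkN : (c - ℓ x) / r ≤ k := hN.trans (by exact_mod_cast hk)
  rw [div_le_iff₀ hr] at hkN
  have h1 := le_supConvolution_self hℓ (Nat.cast_nonneg k) hx
  have h2 : supConvolution D ℓ k x ≤ ℓ x + ε / 2 := by
    refine supConvolution_le ⟨x, hx⟩ fun y hy => ?_
    have hd := dist_le_sum_abs x y
    have hk0 : (0 : ℝ) ≤ k := Nat.cast_nonneg k
    rcases lt_or_ge (dist y x) r with h | h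
    · have h3 := hr' hy h
      rw [Real.dist_eq] at h3
      have := (abs_lt.1 h3).2
      have : 0 ≤ (k : ℝ) * ∑ i, |x i - y i| := by positivity
      linarith
    · rw [dist_comm] at h
      have := mul_le_mul_of_nonneg_left (h.trans hd) hk0
      linarith [hℓ y hy]
  rw [Real.dist_eq, abs_of_nonneg (by linarith)]
  linarith

theorem tendsto_supConvolution_atBot (hD : D.Nonempty) (hℓ : ∀ y ∈ D, ℓ y ≤ c) {x : Fin n → ℝ}
    (hx : x ∉ closure D) :
    Filter.Tendsto (fun k : ℕ => supConvolution D ℓ k x) Filter.atTop Filter.atBot := by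
  rw [Metric.mem_closure_iff] at hx
  push Not at hx
  obtain ⟨r, hr, hxr⟩ := hx
  have h1 : Filter.Tendsto (fun k : ℕ => c + -(k * r : ℝ)) Filter.atTop Filter.atBot :=
    Filter.tendsto_atBot_add_const_left _ _
      (Filter.tendsto_neg_atTop_atBot.comp (tendsto_natCast_atTop_atTop.atTop_mul_const hr))
  refine Filter.tendsto_atBot_mono (fun k => ?_) h1
  refine supConvolution_le hD fun y hy => ?_
  have hd := (hxr y hy).trans (dist_le_sum_abs x y)
  have := mul_le_mul_of_nonneg_left hd (Nat.cast_nonneg (α := ℝ) k)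
  linarith [hℓ y hy]

end SupConvolution

/-! ### Maurey's property for general densities -/

/-- The open unit cube. -/
def openCube (n : ℕ) : Set (Fin n → ℝ) := Set.univ.pi fun _ => Set.Ioo 0 1

theorem mem_openCube {n : ℕ} {x : Fin n → ℝ} : x ∈ openCube n ↔ ∀ i, 0 < x i ∧ x i < 1 := by
  simp [openCube]

theorem convex_openCube (n : ℕ) : Convex ℝ (openCube n) :=
  convex_pi fun _ _ => convex_Ioo 0 1

theorem isOpen_openCube (n : ℕ) : IsOpen (openCube n) :=
  isOpen_set_pi Set.finite_univ fun _ _ => isOpen_Ioo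

theorem openCube_ae_eq_Icc (n : ℕ) : openCube n =ᵐ[volume] Set.Icc 0 1 :=
  Measure.univ_pi_Ioo_ae_eq_Icc

theorem update_mem_openCube {n : ℕ} {x : Fin n → ℝ} (hx : x ∈ openCube n) (i : Fin n) {a : ℝ}
    (ha : 0 < a) (ha1 : a < 1) : Function.update x i a ∈ openCube n := by
  rw [mem_openCube] at *
  intro j
  by_cases hj : j = i
  · subst hj; simpa using ⟨ha, ha1⟩
  · simpa [hj] using hx j

/-- A log-concave function on the open unit cube that, up to the factor `R`, is quasi-convex in
the coordinate directions. -/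
structure IsAdmissibleDensity {n : ℕ} (R : ℝ) (f : (Fin n → ℝ) → ℝ) : Prop where
  nonneg : ∀ x ∈ openCube n, 0 ≤ f x
  logConcave : ∀ x ∈ openCube n, ∀ y ∈ openCube n, ∀ l : ℝ, 0 < l → l < 1 →
    f x ^ l * f y ^ (1 - l) ≤ f (l • x + (1 - l) • y)
  quasiConvex : ∀ x ∈ openCube n, ∀ i, ∀ a b, 0 < a → a ≤ x i → x i ≤ b → b < 1 →
    f x ≤ R * max (f (Function.update x i a)) (f (Function.update x i b))

namespace IsAdmissibleDensity

variable {n : ℕ} {R : ℝ} {f : (Fin n → ℝ) → ℝ}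

/-- The set of positivity of `f` in the open unit cube. -/
def posSet (f : (Fin n → ℝ) → ℝ) : Set (Fin n → ℝ) := {x ∈ openCube n | 0 < f x}

theorem concaveOn_log (hf : IsAdmissibleDensity R f) :
    ConcaveOn ℝ (posSet f) fun x => Real.log (f x) := by
  have key : ∀ x ∈ posSet f, ∀ y ∈ posSet f, ∀ a b : ℝ, 0 < a → 0 < b → a + b = 1 →
      a • x + b • y ∈ posSet f ∧
        a * Real.log (f x) + b * Real.log (f y) ≤ Real.log (f (a • x + b • y)) := by
    intro x hx y hy a b ha hb hab
    obtain rfl : b = 1 - a := by linarith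
    have h1 := hf.logConcave x hx.1 y hy.1 a ha (by linarith)
    have h2 : 0 < f x ^ a * f y ^ (1 - a) :=
      mul_pos (Real.rpow_pos_of_pos hx.2 _) (Real.rpow_pos_of_pos hy.2 _)
    refine ⟨⟨convex_openCube n hx.1 hy.1 ha.le hb.le hab, h2.trans_le h1⟩, ?_⟩
    have h3 := Real.log_le_log h2 h1
    rwa [Real.log_mul (Real.rpow_pos_of_pos hx.2 _).ne' (Real.rpow_pos_of_pos hy.2 _).ne',
      Real.log_rpow hx.2, Real.log_rpow hy.2] at h3
  rw [concaveOn_iff_forall_pos]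
  refine ⟨convex_iff_forall_pos.2 fun x hx y hy a b ha hb hab => (key x hx y hy a b ha hb hab).1,
    fun x hx y hy a b ha hb hab => (key x hx y hy a b ha hb hab).2⟩

theorem concaveOn_log_min (hf : IsAdmissibleDensity R f) (c : ℝ) :
    ConcaveOn ℝ (posSet f) fun x => min (Real.log (f x)) c :=
  hf.concaveOn_log.inf (concaveOn_const c hf.concaveOn_log.1)

theorem exp_log_min {x : Fin n → ℝ} (hx : 0 < f x) (c : ℝ) :
    Real.exp (min (Real.log (f x)) c) = min (f x) (Real.exp c) := by
  rw [Real.exp_monotone.map_min, Real.exp_log hx]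

/-- The approximations of `min f (exp c)` by positive Lipschitz functions. -/
noncomputable def logApprox (f : (Fin n → ℝ) → ℝ) (c k : ℝ) : (Fin n → ℝ) → ℝ :=
  supConvolution (posSet f) (fun x => min (Real.log (f x)) c) k

/-- Moving the `i`-th coordinates of `x` and `y` to `t` and `a` leaves the other terms of the
`ℓ¹`-distance unchanged and makes the `i`-th at most `e`. So the coordinate condition passes from
`f` to its sup-convolution at the price `exp (k * e)`. -/
theorem exp_shift_le_of_quasiConvex (hR : 1 ≤ R) {c k : ℝ} (hk : 0 ≤ k) {x y : Fin n → ℝ}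
    (hy : y ∈ posSet f) (i : Fin n) {a e : ℝ} (ha : 0 < a) (ha1 : a < 1)
    (hle : f y ≤ R * f (Function.update y i a)) {t : ℝ} (hte : |t - a| ≤ e) :
    Real.exp (min (Real.log (f y)) c - k * ∑ j, |x j - y j|) ≤
      R * Real.exp (logApprox f c k (Function.update x i t)) * Real.exp (k * e) := by
  have hR0 : 0 < R := by linarith
  have hpos : 0 < f (Function.update y i a) := by
    have := hy.2.trans_le hle
    exact (pos_iff_pos_of_mul_pos this).1 hR0
  have hmem : Function.update y i a ∈ posSet f := ⟨update_mem_openCube hy.1 i ha ha1, hpos⟩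
  have h1 : Real.exp (min (Real.log (f y)) c) ≤
      R * Real.exp (min (Real.log (f (Function.update y i a))) c) := by
    rw [exp_log_min hy.2, exp_log_min hpos, mul_min_of_nonneg _ _ hR0.le]
    refine min_le_min hle ?_
    nlinarith [Real.exp_pos c]
  have h2 := le_supConvolution (D := posSet f) (ℓ := fun x => min (Real.log (f x)) c) (c := c)
    (fun y _ => min_le_right _ _) hk (Function.update x i t) hmem
  have h3 : ∑ j, |Function.update x i t j - Function.update y i a j| ≤
      ∑ j, |x j - y j| + e := by
    rw [← Finset.add_sum_erase _ _ (Finset.mem_univ i),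
      ← Finset.add_sum_erase _ (fun j => |x j - y j|) (Finset.mem_univ i)]
    have h4 : ∑ j ∈ Finset.univ.erase i, |Function.update x i t j - Function.update y i a j| =
        ∑ j ∈ Finset.univ.erase i, |x j - y j| :=
      Finset.sum_congr rfl fun j hj => by simp [(Finset.mem_erase.1 hj).1]
    rw [h4]
    simp only [Function.update_self]
    linarith [abs_nonneg (x i - y i)]
  have h5 : min (Real.log (f (Function.update y i a))) c - k * ∑ j, |x j - y j| ≤
      logApprox f c k (Function.update x i t) + k * e := by
    have := mul_le_mul_of_nonneg_left h3 hk
    rw [logApprox]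
    linarith
  calc Real.exp (min (Real.log (f y)) c - k * ∑ j, |x j - y j|)
      = Real.exp (min (Real.log (f y)) c) * Real.exp (-(k * ∑ j, |x j - y j|)) := by
        rw [← Real.exp_add, sub_eq_add_neg]
    _ ≤ R * Real.exp (min (Real.log (f (Function.update y i a))) c) *
          Real.exp (-(k * ∑ j, |x j - y j|)) := by gcongr
    _ = R * Real.exp (min (Real.log (f (Function.update y i a))) c -
          k * ∑ j, |x j - y j|) := by
        rw [mul_assoc, ← Real.exp_add, sub_eq_add_neg]
    _ ≤ R * Real.exp (logApprox f c k (Function.update x i t) + k * e) := by gcongr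
    _ = _ := by rw [Real.exp_add, mul_assoc]

theorem boundedByFaces_exp_logApprox (hf : IsAdmissibleDensity R f) (hR : 1 ≤ R)
    (hD : (posSet f).Nonempty) (c : ℝ) {k : ℝ} (hk : 0 ≤ k) :
    BoundedByFaces R fun x => Real.exp (logApprox f c k x) := by
  intro x _ i
  have hR0 : 0 < R := by linarith
  set M := max (Real.exp (logApprox f c k (Function.update x i 0)))
    (Real.exp (logApprox f c k (Function.update x i 1))) with hM
  have hM0 : 0 < R * M := mul_pos hR0 (lt_max_of_lt_left (Real.exp_pos _))
  suffices h : logApprox f c k x ≤ Real.log (R * M) by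
    have := Real.exp_le_exp.2 h
    rwa [Real.exp_log hM0] at this
  refine supConvolution_le hD fun y hy => ?_
  rw [Real.le_log_iff_exp_le hM0]
  have hyi := mem_openCube.1 hy.1 i
  -- Nothing is known of `f` on the faces, so end points at distance `e` from them are used and `e`
  -- tends to `0`.
  have hev : ∀ᶠ e in nhdsWithin (0 : ℝ) (Set.Ioi 0),
      Real.exp (min (Real.log (f y)) c - k * ∑ j, |x j - y j|) ≤ R * M * Real.exp (k * e) := by
    have hsmall : ∀ᶠ e in nhdsWithin (0 : ℝ) (Set.Ioi 0), e < min (y i) (1 - y i) :=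
      nhdsWithin_le_nhds (eventually_lt_nhds (lt_min hyi.1 (by linarith)))
    filter_upwards [hsmall, self_mem_nhdsWithin] with e he he0
    have he0 : 0 < e := he0
    have he1 := he.trans_le (min_le_left _ _)
    have he2 := he.trans_le (min_le_right _ _)
    have h1 := hf.quasiConvex y hy.1 i e (1 - e) he0 he1.le (by linarith) (by linarith)
    rcases max_choice (f (Function.update y i e)) (f (Function.update y i (1 - e))) with h | h
    · rw [h] at h1
      refine (exp_shift_le_of_quasiConvex hR hk hy i he0 (by linarith) h1 (t := 0) (e := e)
        (by rw [zero_sub, abs_neg, abs_of_pos he0])).trans ?_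
      have := le_max_left (Real.exp (logApprox f c k (Function.update x i 0)))
        (Real.exp (logApprox f c k (Function.update x i 1)))
      gcongr
    · rw [h] at h1
      refine (exp_shift_le_of_quasiConvex hR hk hy i (by linarith) (by linarith) h1 (t := 1)
        (e := e) (by rw [sub_sub_cancel, abs_of_pos he0])).trans ?_
      have := le_max_right (Real.exp (logApprox f c k (Function.update x i 0)))
        (Real.exp (logApprox f c k (Function.update x i 1)))
      gcongr
  have hlim : Filter.Tendsto (fun e => R * M * Real.exp (k * e)) (nhdsWithin (0 : ℝ) (Set.Ioi 0))
      (nhds (R * M)) := by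
    have : Continuous fun e : ℝ => R * M * Real.exp (k * e) := by fun_prop
    simpa using (this.tendsto 0).mono_left nhdsWithin_le_nhds
  exact ge_of_tendsto hlim hev

/-- Inside the convex set `posSet f` the concave logarithm is continuous and the sup-convolutions
converge to it; off the closure they tend to `-∞`, where `f` is zero. The frontier of a convex set
is null. -/
theorem tendsto_exp_logApprox (hf : IsAdmissibleDensity R f) (hD : (posSet f).Nonempty) (c : ℝ) :
    ∀ᵐ x ∂(volume.restrict (Set.Icc (0 : Fin n → ℝ) 1)),
      Filter.Tendsto (fun k : ℕ => Real.exp (logApprox f c k x)) Filter.atTop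
        (nhds (min (f x) (Real.exp c))) := by
  rw [← Measure.restrict_congr_set (openCube_ae_eq_Icc n)]
  have hfr : ∀ᵐ x ∂(volume : Measure (Fin n → ℝ)), x ∉ frontier (posSet f) :=
    measure_eq_zero_iff_ae_notMem.1 (hf.concaveOn_log.1.addHaar_frontier volume)
  have hℓ : ∀ y ∈ posSet f, min (Real.log (f y)) c ≤ c := fun y _ => min_le_right _ _
  filter_upwards [ae_restrict_mem (isOpen_openCube n).measurableSet, ae_restrict_of_ae hfr]
    with x hx hxf
  by_cases hcl : x ∈ closure (posSet f)
  · have hint : x ∈ interior (posSet f) := by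
      by_contra h
      exact hxf ⟨hcl, h⟩
    have hxD := interior_subset hint
    have hcont : ContinuousAt (fun x => min (Real.log (f x)) c) x :=
      (hf.concaveOn_log_min c).continuousOn_interior.continuousAt (isOpen_interior.mem_nhds hint)
    have := (Real.continuous_exp.tendsto _).comp
      (tendsto_supConvolution_of_continuousAt hℓ hxD hcont.continuousWithinAt)
    rwa [exp_log_min hxD.2] at this
  · have h0 : f x = 0 := by
      refine le_antisymm (not_lt.1 fun h => hcl (subset_closure ⟨hx, h⟩)) (hf.nonneg x hx)
    rw [h0, min_eq_left (Real.exp_pos c).le]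
    exact Real.tendsto_exp_atBot.comp (tendsto_supConvolution_atBot hD hℓ hcl)

/-- Maurey's property for an admissible density and the distance to a set. -/
theorem integral_mul_integral_exp_sq_le (hf : IsAdmissibleDensity R f) (hR : 1 ≤ R)
    (hD : (posSet f).Nonempty) (hfi : IntegrableOn f (Set.Icc 0 1)) {δ : (Fin n → ℝ) → ℝ}
    (hδ : Continuous δ) (hδ0 : ∀ x, 0 ≤ δ x) (hδl : IsEuclideanShort δ) {A : Set (Fin n → ℝ)}
    (hA : MeasurableSet A) (hδA : ∀ x ∈ A, δ x = 0) :
    (∫ x in A, f x ∂(volume.restrict (Set.Icc 0 1))) *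
        ∫ x in Set.Icc 0 1, Real.exp (δ x ^ 2 / (4 * R)) * f x ≤
      (∫ x in Set.Icc 0 1, f x) ^ 2 := by
  have hEm : AEStronglyMeasurable (fun x => Real.exp (δ x ^ 2 / (4 * R)))
      (volume.restrict (Set.Icc (0 : Fin n → ℝ) 1)) :=
    Continuous.aestronglyMeasurable (by fun_prop)
  obtain ⟨M, hM⟩ := (isCompact_Icc (a := (0 : Fin n → ℝ)) (b := 1)).exists_bound_of_continuousOn
    (f := fun x => Real.exp (δ x ^ 2 / (4 * R))) (by fun_prop)
  have hEM : ∀ᵐ x ∂(volume.restrict (Set.Icc (0 : Fin n → ℝ) 1)),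
      ‖Real.exp (δ x ^ 2 / (4 * R))‖ ≤ M := by
    filter_upwards [ae_restrict_mem measurableSet_Icc] with x hx using hM x hx
  have hf0 : ∀ᵐ x ∂(volume.restrict (Set.Icc (0 : Fin n → ℝ) 1)), 0 ≤ f x := by
    rw [← Measure.restrict_congr_set (openCube_ae_eq_Icc n)]
    filter_upwards [ae_restrict_mem (isOpen_openCube n).measurableSet] with x hx
    exact hf.nonneg x hx
  -- Two successive limits: `k → ∞` dominated by the constant `exp c`, then `c → ∞` dominated by
  -- `f`.
  have htrunc : ∀ c : ℕ, (∫ x in A, min (f x) (Real.exp c) ∂(volume.restrict (Set.Icc 0 1))) *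
        ∫ x in Set.Icc 0 1, Real.exp (δ x ^ 2 / (4 * R)) * min (f x) (Real.exp c) ≤
      (∫ x in Set.Icc 0 1, min (f x) (Real.exp c)) ^ 2 := by
    intro c
    have hℓ : ∀ y ∈ posSet f, min (Real.log (f y)) (c : ℝ) ≤ c := fun y _ => min_le_right _ _
    have hlip : ∀ k : ℕ, LipschitzWith _ (logApprox f c k) := fun k =>
      lipschitzWith_supConvolution hD hℓ (Nat.cast_nonneg k)
    have hcont : ∀ k : ℕ, Continuous (logApprox f c k) := fun k => (hlip k).continuous
    refine integral_mul_integral_le_of_tendsto (ρs := fun k x => Real.exp (logApprox f c k x))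
      (B := fun _ => Real.exp c) (fun k => ?_) ?_ (fun k => Filter.Eventually.of_forall fun x => ?_)
      (hf.tendsto_exp_logApprox hD c) hEm hEM fun k => ?_
    · exact (Real.continuous_exp.comp (hcont k)).aestronglyMeasurable
    · exact continuous_const.integrableOn_Icc
    · rw [Real.norm_of_nonneg (Real.exp_pos _).le]
      exact Real.exp_le_exp.2 (supConvolution_le_bound hD hℓ (Nat.cast_nonneg k) x)
    · exact _root_.integral_mul_integral_exp_sq_le hR (hlip k)
        (concaveOn_supConvolution hD hℓ (Nat.cast_nonneg k) (hf.concaveOn_log_min c))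
        (hf.boundedByFaces_exp_logApprox hR hD c (Nat.cast_nonneg k)) hδ hδ0 hδl hA hδA
  refine integral_mul_integral_le_of_tendsto (ρs := fun (c : ℕ) x => min (f x) (Real.exp c))
    (fun c => hfi.aestronglyMeasurable.inf aestronglyMeasurable_const) hfi (fun c => ?_) ?_ hEm hEM
    htrunc
  · filter_upwards [hf0] with x hx
    rw [Real.norm_of_nonneg (le_min hx (Real.exp_pos _).le)]
    exact min_le_left _ _
  · refine Filter.Eventually.of_forall fun x => ?_
    have h1 : Filter.Tendsto (fun c : ℕ => Real.exp c) Filter.atTop Filter.atTop :=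
      Real.tendsto_exp_atTop.comp tendsto_natCast_atTop_atTop
    refine tendsto_const_nhds.congr' ?_
    filter_upwards [h1.eventually_ge_atTop (f x)] with c hc
    rw [min_eq_left hc]

end IsAdmissibleDensity

/-! ### Transfer from the standard cube to Euclidean space -/

/-- The measurable equivalence `x ↦ a + x` onto Euclidean space. -/
noncomputable def translateToLp {n : ℕ} (a : EuclideanSpace ℝ (Fin n)) :
    (Fin n → ℝ) ≃ᵐ EuclideanSpace ℝ (Fin n) :=
  (MeasurableEquiv.toLp 2 (Fin n → ℝ)).trans (MeasurableEquiv.addLeft a)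

section TranslateToLp

variable {n : ℕ} (a : EuclideanSpace ℝ (Fin n))

@[simp] theorem translateToLp_apply (x : Fin n → ℝ) (i : Fin n) :
    translateToLp a x i = a i + x i := rfl

theorem measurePreserving_translateToLp :
    MeasurePreserving (translateToLp a) volume volume :=
  (measurePreserving_add_left volume a).comp (PiLp.volume_preserving_toLp (Fin n))

theorem continuous_translateToLp : Continuous (translateToLp a) :=
  continuous_const.add (PiLp.continuous_toLp 2 _)

theorem dist_translateToLp (x y : Fin n → ℝ) :
    dist (translateToLp a x) (translateToLp a y) = √(∑ i, (x i - y i) ^ 2) := by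
  rw [EuclideanSpace.dist_eq]
  simp [Real.dist_eq, sq_abs]

theorem translateToLp_combination (x y : Fin n → ℝ) (l : ℝ) :
    translateToLp a (l • x + (1 - l) • y) =
      l • translateToLp a x + (1 - l) • translateToLp a y := by
  ext i; simp; ring

end TranslateToLp

theorem IsUnitCube.exists_translateToLp {n : ℕ} {Q : Set (EuclideanSpace ℝ (Fin n))}
    (hQ : IsUnitCube Q) : ∃ a, (∀ x ∈ openCube n, translateToLp a x ∈ Q) ∧
      (volume : Measure (Fin n → ℝ)).restrict (translateToLp a ⁻¹' Q) =
        volume.restrict (Set.Icc 0 1) := by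
  obtain ⟨a, rfl | rfl⟩ := hQ
  · have h : translateToLp a ⁻¹' {x | ∀ i, x i ∈ Set.Ioo (a i) (a i + 1)} = openCube n := by
      ext x; simp [mem_openCube]
    refine ⟨a, fun x hx => ?_, ?_⟩
    · rwa [← h] at hx
    · rw [h]; exact Measure.restrict_congr_set (openCube_ae_eq_Icc n)
  · have h : translateToLp a ⁻¹' {x | ∀ i, x i ∈ Set.Icc (a i) (a i + 1)} = Set.Icc 0 1 := by
      ext x; simp [Pi.le_def, forall_and]
    refine ⟨a, fun x hx => ?_, by rw [h]⟩
    have hx' : x ∈ Set.Icc (0 : Fin n → ℝ) 1 :=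
      ⟨fun i => (mem_openCube.1 hx i).1.le, fun i => (mem_openCube.1 hx i).2.le⟩
    rwa [← h] at hx'

theorem isAdmissibleDensity_comp_translateToLp {n : ℕ} {R : ℝ} (hR : 1 ≤ R)
    {Q : Set (EuclideanSpace ℝ (Fin n))} {f : EuclideanSpace ℝ (Fin n) → ℝ}
    (hf : IsLogConcaveOn Q f) (hfR : IsApproxConvexAlongAxes R Q f)
    {a : EuclideanSpace ℝ (Fin n)} (ha : ∀ x ∈ openCube n, translateToLp a x ∈ Q) :
    IsAdmissibleDensity R (fun x => f (translateToLp a x)) := by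
  obtain ⟨-, hf0, hlc⟩ := hf
  refine ⟨fun x hx => hf0 _ (ha x hx), fun x hx y hy l hl hl1 => ?_, ?_⟩
  · rw [translateToLp_combination]
    exact hlc _ (ha x hx) _ (ha y hy) l hl hl1
  · intro x hx i b c hb hbx hxc hc
    have hR0 : 0 ≤ R := by linarith
    have hxb : Function.update x i b ∈ openCube n :=
      update_mem_openCube hx i hb (by linarith)
    have hxc' : Function.update x i c ∈ openCube n :=
      update_mem_openCube hx i (by linarith) hc
    set M := max (f (translateToLp a (Function.update x i b)))
      (f (translateToLp a (Function.update x i c)))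
    have hM0 : 0 ≤ M := (hf0 _ (ha _ hxb)).trans (le_max_left _ _)
    have hM : M ≤ R * M := le_mul_of_one_le_left hM0 hR
    -- The hypothesis needs `0 < l < 1`, so the cases where `x` is an end point are separate; they
    -- use `1 ≤ R`.
    rcases hbx.eq_or_lt with h | hbx
    · refine le_trans ?_ hM
      rw [show x = Function.update x i b by rw [h, Function.update_eq_self]]
      exact le_max_left _ _
    rcases hxc.eq_or_lt with h | hxc
    · refine le_trans ?_ hM
      rw [show x = Function.update x i c by rw [← h, Function.update_eq_self]]
      exact le_max_right _ _
    set l := (c - x i) / (c - b) with hl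
    have hcb : 0 < c - b := by linarith
    have hl0 : 0 < l := div_pos (by linarith) hcb
    have hl1 : l < 1 := by rw [hl, div_lt_one hcb]; linarith
    have hx' : x = l • Function.update x i b + (1 - l) • Function.update x i c := by
      ext j
      by_cases hj : j = i
      · subst hj
        simp only [Pi.add_apply, Pi.smul_apply, Function.update_self, smul_eq_mul, hl]
        field_simp; ring
      · simp [hj]; ring
    have hdir : IsCoordinateDirection (translateToLp a (Function.update x i b) -
        translateToLp a (Function.update x i c)) := by
      have : ∀ j, (translateToLp a (Function.update x i b) -
          translateToLp a (Function.update x i c)) j ≠ 0 → j = i := by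
        intro j
        contrapose!
        intro hj
        simp [hj]
      intro j j' h h'
      rw [this j h, this j' h']
    have h1 := hfR _ (ha _ hxb) _ (ha _ hxc') hdir l hl0 hl1
    rw [← translateToLp_combination, ← hx'] at h1
    refine h1.trans (mul_le_mul_of_nonneg_left ?_ hR0)
    nlinarith [mul_le_mul_of_nonneg_left (le_max_left
        (f (translateToLp a (Function.update x i b))) (f (translateToLp a (Function.update x i c))))
        hl0.le,
      mul_le_mul_of_nonneg_left (le_max_right
        (f (translateToLp a (Function.update x i b))) (f (translateToLp a (Function.update x i c))))
        (by linarith : 0 ≤ 1 - l)]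

/-! ### Conclusion: from Maurey's property to concentration -/

/-- Multiplying the two bounds gives `b^2 exp s ≤ 1`: the factor `2` is absorbed at the price of
half the exponent. -/
theorem le_exp_of_le_two_mul_exp {b s u : ℝ} (hb0 : 0 ≤ b) (hb : b ≤ 1 / 2)
    (hbs : b * Real.exp s ≤ 2) (hu : 2 * u ≤ s) : b ≤ Real.exp (-u) := by
  have h1 : (b * Real.exp u) ^ 2 ≤ 1 := by
    calc (b * Real.exp u) ^ 2 = b * (b * Real.exp (2 * u)) := by
          rw [two_mul, Real.exp_add]; ring
      _ ≤ b * (b * Real.exp s) := by gcongr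
      _ ≤ 1 / 2 * 2 := by gcongr
      _ = 1 := by norm_num
  have h2 : b * Real.exp u ≤ 1 := by
    have := abs_le_of_sq_le_sq' (a := b * Real.exp u) (b := 1) (by simpa using h1) zero_le_one
    exact this.2
  rw [Real.exp_neg, ← one_div, le_div_iff₀ (Real.exp_pos u)]
  exact h2

theorem infDist_lt_subset_add_smul_closedBall {n : ℕ} {A : Set (EuclideanSpace ℝ (Fin n))}
    (hA : A.Nonempty) {t : ℝ} (ht : 0 < t) :
    {x | Metric.infDist x A < t} ⊆
      A + t • Metric.closedBall (0 : EuclideanSpace ℝ (Fin n)) 1 := by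
  intro x hx
  obtain ⟨y, hy, hxy⟩ := (Metric.infDist_lt_iff hA).1 hx
  rw [smul_unitClosedBall_of_nonneg ht.le]
  refine Set.mem_add.2 ⟨y, hy, x - y, ?_, by abel⟩
  rw [mem_closedBall_zero_iff, ← dist_eq_norm]
  exact hxy.le

theorem theorem2 (n : ℕ) (R : ℝ) (hR : 1 ≤ R)
    (Q : Set (EuclideanSpace ℝ (Fin n))) (hQ : IsUnitCube Q)
    (μ : Measure (EuclideanSpace ℝ (Fin n))) [IsProbabilityMeasure μ]
    (f : EuclideanSpace ℝ (Fin n) → ℝ) (hμ : HasDensityOn μ Q f)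
    (hf : IsLogConcaveOn Q f) (hfR : IsApproxConvexAlongAxes R Q f)
    (A : Set (EuclideanSpace ℝ (Fin n))) (hA : MeasurableSet A) (hμA : 1 / 2 ≤ μ.real A)
    (t : ℝ) (ht : 0 < t) :
    1 - Real.exp (-(t ^ 2 / (3 * R) ^ 2)) ≤
      μ.real (A + t • Metric.closedBall (0 : EuclideanSpace ℝ (Fin n)) 1) := by
  obtain ⟨a, ha, hres⟩ := hQ.exists_translateToLp
  obtain ⟨hfm, hμ⟩ := hμ
  have hR0 : 0 < R := by linarith
  set Ψ := translateToLp a with hΨ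
  set ν : Measure (Fin n → ℝ) := volume.restrict (Set.Icc 0 1) with hν
  have hadm := isAdmissibleDensity_comp_translateToLp hR hf hfR ha
  have hmp : MeasurePreserving Ψ ν (volume.restrict Q) := by
    rw [← hres]
    exact (measurePreserving_translateToLp a).restrict_preimage_emb Ψ.measurableEmbedding Q
  set f0 : (Fin n → ℝ) → ℝ := fun x => f (Ψ x) with hf0
  have hf0m : AEMeasurable f0 ν := (hmp.aemeasurable_comp_iff Ψ.measurableEmbedding).2 hfm
  have hf0nn : 0 ≤ᵐ[ν] f0 := by
    rw [hν, ← Measure.restrict_congr_set (openCube_ae_eq_Icc n)]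
    filter_upwards [ae_restrict_mem (isOpen_openCube n).measurableSet] with x hx
    exact hadm.nonneg x hx
  have hμB : ∀ B, MeasurableSet B → μ B = ∫⁻ x in Ψ ⁻¹' B, ENNReal.ofReal (f0 x) ∂ν := by
    intro B hB
    rw [hμ, withDensity_apply _ hB]
    exact (hmp.setLIntegral_comp_preimage_emb Ψ.measurableEmbedding
      (fun x => ENNReal.ofReal (f x)) B).symm
  have hreal : ∀ B, MeasurableSet B → μ.real B = ∫ x in Ψ ⁻¹' B, f0 x ∂ν := by
    intro B hB
    rw [measureReal_def, hμB B hB, integral_eq_lintegral_of_nonneg_ae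
      (ae_restrict_of_ae hf0nn) hf0m.aestronglyMeasurable.restrict]
  have htot : ∫ x, f0 x ∂ν = 1 := by
    have := hreal Set.univ MeasurableSet.univ
    rw [Set.preimage_univ, Measure.restrict_univ, probReal_univ] at this
    exact this.symm
  -- A non-integrable function would have integral `0` by convention.
  have hfi : Integrable f0 ν := Integrable.of_integral_ne_zero (by rw [htot]; exact one_ne_zero)
  have hD : (IsAdmissibleDensity.posSet f0).Nonempty := by
    by_contra hD
    rw [Set.not_nonempty_iff_eq_empty, Set.eq_empty_iff_forall_notMem] at hD
    have : f0 =ᵐ[ν] 0 := by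
      rw [hν, ← Measure.restrict_congr_set (openCube_ae_eq_Icc n)]
      filter_upwards [ae_restrict_mem (isOpen_openCube n).measurableSet] with x hx
      exact le_antisymm (not_lt.1 fun h => hD x ⟨hx, h⟩) (hadm.nonneg x hx)
    rw [integral_congr_ae this] at htot
    simp at htot
  have hAne : A.Nonempty := by
    rw [Set.nonempty_iff_ne_empty]
    rintro rfl
    norm_num at hμA
  set δ : (Fin n → ℝ) → ℝ := fun x => Metric.infDist (Ψ x) A with hδ
  have hδc : Continuous δ := (Metric.continuous_infDist_pt A).comp (continuous_translateToLp a)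
  have hδ0 : ∀ x, 0 ≤ δ x := fun x => Metric.infDist_nonneg
  have hmaurey := hadm.integral_mul_integral_exp_sq_le hR hD hfi hδc hδ0
    (fun x y => by
      rw [← dist_translateToLp a]
      exact Metric.infDist_le_infDist_add_dist)
    (Ψ.measurable hA) (fun x hx => Metric.infDist_zero_of_mem hx)
  rw [← hν] at hmaurey
  change (∫ x in Ψ ⁻¹' A, f0 x ∂ν) * (∫ x, Real.exp (δ x ^ 2 / (4 * R)) * f0 x ∂ν) ≤
    (∫ x, f0 x ∂ν) ^ 2 at hmaurey
  rw [htot, ← hreal A hA, one_pow] at hmaurey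
  set J := ∫ x, Real.exp (δ x ^ 2 / (4 * R)) * f0 x ∂ν with hJ
  have hEnn : 0 ≤ᵐ[ν] fun x => Real.exp (δ x ^ 2 / (4 * R)) * f0 x := by
    filter_upwards [hf0nn] with x hx using mul_nonneg (Real.exp_pos _).le hx
  have hJ2 : J ≤ 2 := by
    have hJ0 : 0 ≤ J := integral_nonneg_of_ae hEnn
    nlinarith
  -- The open neighbourhood `S` is measurable and lies in `A + t B`, so monotonicity finishes
  -- without measurability of the sum.
  set S : Set (EuclideanSpace ℝ (Fin n)) := {x | Metric.infDist x A < t} with hS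
  have hSm : MeasurableSet S :=
    (isOpen_lt (Metric.continuous_infDist_pt A) continuous_const).measurableSet
  have hEi : Integrable (fun x => Real.exp (δ x ^ 2 / (4 * R)) * f0 x) ν := by
    obtain ⟨M, hM⟩ := (isCompact_Icc (a := (0 : Fin n → ℝ)) (b := 1)).exists_bound_of_continuousOn
      (f := fun x => Real.exp (δ x ^ 2 / (4 * R))) (by fun_prop)
    refine hfi.bdd_mul (c := M) (Continuous.aestronglyMeasurable (by fun_prop)) ?_
    filter_upwards [ae_restrict_mem measurableSet_Icc] with x hx using hM x hx
  have hmarkov : μ.real Sᶜ * Real.exp (t ^ 2 / (4 * R)) ≤ 2 := by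
    rw [hreal _ hSm.compl, ← integral_mul_const]
    refine le_trans ?_ ((setIntegral_le_integral (s := Ψ ⁻¹' Sᶜ) hEi hEnn).trans hJ2)
    refine integral_mono_ae (hfi.restrict.mul_const _) hEi.restrict ?_
    filter_upwards [ae_restrict_mem (Ψ.measurable hSm.compl), ae_restrict_of_ae hf0nn] with x hx hx0
    have hxt : t ≤ δ x := not_lt.1 hx
    rw [mul_comm]
    have hx0 : 0 ≤ f0 x := hx0
    gcongr
  have hAS : A ⊆ S := fun x hx => by
    simpa [hS, Metric.infDist_zero_of_mem hx] using ht
  have hScompl : μ.real Sᶜ = 1 - μ.real S := probReal_compl_eq_one_sub hSm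
  have hhalf : μ.real Sᶜ ≤ 1 / 2 := by
    have := measureReal_mono (μ := μ) hAS
    linarith
  -- This is `8 * R ≤ 9 * R ^ 2`, where the constant `3` leaves room.
  have hu : 2 * (t ^ 2 / (3 * R) ^ 2) ≤ t ^ 2 / (4 * R) := by
    rw [← mul_div_assoc, div_le_div_iff₀ (by positivity) (by positivity)]
    nlinarith [mul_nonneg (mul_nonneg (sq_nonneg t) hR0.le) (by linarith : 0 ≤ 9 * R - 8)]
  have hfinal := le_exp_of_le_two_mul_exp measureReal_nonneg hhalf hmarkov hu
  have hsub := measureReal_mono (μ := μ) (infDist_lt_subset_add_smul_closedBall hAne ht)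
  rw [← hS] at hsub
  linarith
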